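/- Conventions. A stabilizer code on $n$ qubits is given by an abelian subgroup $S$ of the $n$-qubit Pauli group with $-I\notin S$; if $S$ has $m$ independent generators, it encodes $k=n-m$ qubits. Its distance is the least weight of a Pauli operator that commutes with every element of $S$ and is not, up to a phase, in $S$ ($\infty$ if $k=0$). Logical operators $X_L^{(j)},Z_L^{(j)}$ ($1\le j\le k$) are Pauli observables commuting with $S$ that satisfy the usual (anti)commutation relations of $k$ qubits. A Clifford operator on the code is a unitary that preserves the code space and whose action there normalizes the logical Pauli group; operators are considered up to a global phase. A subsystem stabilizer code $\widehat C$ with $r$ gauge qubits is a stabilizer code in which $r$ of the encoded qubits are designated as gauge qubits; its distance is the distance of this stabilizer code (the gauge qubits being counted among the encoded qubits). Fixing $s$ gauge qubits means adding $s$ independent elements of the gauge group (generated by the phases, the stabilizers and the Pauli operators of the gauge qubits) to the stabilizer group so that the result $C$ is again a stabilizer code. Given stabilizer generators $g_1,\dots,g_m$ of $C$, one of them singled out as $g_\ell$, a code rewiring pair is a pair $(g,g')$ of Pauli observables such that $g$ and $g'$ both anticommute with $g_\ell$ and commute with all other generators, $g$ commutes with all the logical operators $X_L^{(j)},Z_L^{(j)}$,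 and $g$ anticommutes with $g'$. The elementary code rewiring is: measure $g$ and apply $g_\ell$ if the outcome is $-1$; measure $g'$ and apply $g$ if the outcome is $-1$; measure $g_\ell$ and apply $g'$ if the outcome is $-1$. Its intermediate codes are those whose stabilizer generators are obtained by replacing $g_\ell$ by $g$, respectively by $g'$. Theorem. (1) Let $\widehat C$ be a subsystem stabilizer code with $r\ge 1$ gauge qubits and distance $d$, and let $C$ be a stabilizer code obtained from $\widehat C$ by fixing at least one gauge qubit. Then $C$ has distance at least $d$, and $C$ has a set of independent stabilizer generators such that, for every choice of logical operators of $C$, every Clifford operator on $C$ is induced by a finite sequence of elementary code rewirings of these generators all of whose intermediate codes are stabilizer codes of distance at least $d$. (2) Let $h_1,\dots,h_4\in\mathbb F_2^{15}$ be the rows of the parity check matrix of the Hamming code whose columns are the binary expansions of $1,\dots,15$. The stabilizer code with generators $X_{h_i},Z_{h_i}$ is a $[[15,7,3]]$ code. Six of its encoded qubits can be designated as gauge qubits and fixed so as to give the 15-qubit Reed–Muller code, which has generators $X_{h_i}$, $Z_{h_i}$, $Z_{h_ih_j}$ ($i<j$, $h_ih_j$ the entrywise product), encodes one qubit with logical operators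 $X_L=X^{\otimes 15}$ and $Z_L=Z^{\otimes 15}$, and has distance at least $3$. On this code a single elementary code rewiring (three measurements), both of whose intermediate codes are stabilizer codes of distance at least $3$, induces an operator of $\sqrt Y$-type, that is, $\sqrt{Y_L}$ or $Y_L\sqrt{Y_L}$, where $Y_L=iX_LZ_L$. -/

import Mathlib

open scoped Matrix ComplexOrder

/-- The Pauli operator `i ^ phase * X_x * Z_z` on `n` qubits; these elements form the `n`-qubit
Pauli group. -/
@[ext]
structure Pauli (n : ℕ) where
  phase : ZMod 4
  x : Fin n → ZMod 2
  z : Fin n → ZMod 2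

namespace Pauli

variable {n : ℕ}

/-- The exponent of `i` which represents the sign `(-1) ^ a`. -/
def signPhase (a : ZMod 2) : ZMod 4 := if a = 0 then 0 else 2

theorem signPhase_add (a b : ZMod 2) : signPhase (a + b) = signPhase a + signPhase b := by
  revert a b; decide

theorem signPhase_add_self (a : ZMod 2) : signPhase a + signPhase a = 0 := by
  revert a; decide

/-- Multiplication of Pauli operators, by `Z_b X_c = (-1) ^ (b ⬝ c) X_c Z_b`. -/
instance : Mul (Pauli n) :=
  ⟨fun P Q => ⟨P.phase + Q.phase + signPhase (P.z ⬝ᵥ Q.x), P.x + Q.x, P.z + Q.z⟩⟩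

instance : One (Pauli n) := ⟨⟨0, 0, 0⟩⟩

instance : Inv (Pauli n) := ⟨fun P => ⟨-P.phase + signPhase (P.z ⬝ᵥ P.x), P.x, P.z⟩⟩

theorem mul_def (P Q : Pauli n) :
    P * Q = ⟨P.phase + Q.phase + signPhase (P.z ⬝ᵥ Q.x), P.x + Q.x, P.z + Q.z⟩ := rfl

theorem one_def : (1 : Pauli n) = ⟨0, 0, 0⟩ := rfl

theorem inv_def (P : Pauli n) :
    P⁻¹ = ⟨-P.phase + signPhase (P.z ⬝ᵥ P.x), P.x, P.z⟩ := rfl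

/-- The Pauli group. -/
instance : Group (Pauli n) :=
  Group.ofLeftAxioms
    (fun P Q R => by
      simp only [mul_def, add_dotProduct, dotProduct_add, signPhase_add, Pauli.mk.injEq]
      exact ⟨by ring, add_assoc _ _ _, add_assoc _ _ _⟩)
    (fun P => by
      simp only [mul_def, one_def, zero_dotProduct, zero_add]
      ext <;> simp [signPhase])
    (fun P => by
      simp only [mul_def, inv_def, one_def, Pauli.mk.injEq]
      refine ⟨?_, funext fun j => CharTwo.add_self_eq_zero _,
        funext fun j => CharTwo.add_self_eq_zero _⟩
      have h := signPhase_add_self (P.z ⬝ᵥ P.x)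
      linear_combination h)

/-- The scalar operator `-I`. -/
def negOne (n : ℕ) : Pauli n := ⟨2, 0, 0⟩

/-- The scalar operator `i I`. -/
def imag (n : ℕ) : Pauli n := ⟨1, 0, 0⟩

/-- The operator `X_v`. -/
def ofX (v : Fin n → ZMod 2) : Pauli n := ⟨0, v, 0⟩

/-- The operator `Z_v`. -/
def ofZ (v : Fin n → ZMod 2) : Pauli n := ⟨0, 0, v⟩

/-- `P` and `Q` anticommute. -/
def AntiCommute (P Q : Pauli n) : Prop := P * Q = negOne n * (Q * P)

/-- A Pauli operator is an observable (i.e. Hermitian) iff its square is the identity. -/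
def IsObservable (P : Pauli n) : Prop := P * P = 1

/-- The number of qubits on which `P` acts non-trivially. -/
def weight (P : Pauli n) : ℕ := (Finset.univ.filter fun j => P.x j ≠ 0 ∨ P.z j ≠ 0).card

end Pauli

/-- Operators on the Hilbert space of `n` qubits, whose computational basis is indexed by
`Fin n → ZMod 2`. -/
abbrev QubitOp (n : ℕ) := Matrix (Fin n → ZMod 2) (Fin n → ZMod 2) ℂ

/-- `X_v |w⟩ = |w + v⟩`. -/
def matX {n : ℕ} (v : Fin n → ZMod 2) : QubitOp n :=
  Matrix.of fun a w => if a = w + v then 1 else 0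

/-- `Z_v |w⟩ = (-1) ^ (v ⬝ w) |w⟩`. -/
def matZ {n : ℕ} (v : Fin n → ZMod 2) : QubitOp n :=
  Matrix.diagonal fun w => (-1) ^ (v ⬝ᵥ w).val

/-- The operator on the Hilbert space given by a Pauli group element. -/
noncomputable def Pauli.toMatrix {n : ℕ} (P : Pauli n) : QubitOp n :=
  (Complex.I ^ P.phase.val) • (matX P.x * matZ P.z)

/-- A stabilizer code on `n` qubits, given by its stabilizer group: an abelian subgroup of the
Pauli group which does not contain `-I`. -/
structure StabilizerCode (n : ℕ) where
  stab : Subgroup (Pauli n)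
  comm : ∀ P ∈ stab, ∀ Q ∈ stab, Commute P Q
  negOne_notMem : Pauli.negOne n ∉ stab

namespace StabilizerCode

variable {n : ℕ}

/-- The code space: the common `+1` eigenspace of the stabilizers. -/
def codeSpace (C : StabilizerCode n) : Submodule ℂ ((Fin n → ZMod 2) → ℂ) where
  carrier := {ψ | ∀ P ∈ C.stab, P.toMatrix *ᵥ ψ = ψ}
  add_mem' := fun ha hb P hP => by rw [Matrix.mulVec_add, ha P hP, hb P hP]
  zero_mem' := fun P _ => Matrix.mulVec_zero _
  smul_mem' := fun c ψ h P hP => by rw [Matrix.mulVec_smul, h P hP]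

/-- The logical Pauli operators: the Pauli operators that commute with every stabilizer. -/
def logicalPaulis (C : StabilizerCode n) : Subgroup (Pauli n) :=
  Subgroup.centralizer (C.stab : Set (Pauli n))

/-- The minimum weight of a logical Pauli operator that is not, up to a phase, a stabilizer
(`⊤` if there is none, i.e. if no qubit is encoded). -/
noncomputable def distance (C : StabilizerCode n) : ℕ∞ :=
  ⨅ P ∈ {P : Pauli n | P ∈ C.logicalPaulis ∧ ¬ ∃ Q ∈ C.stab, Q.x = P.x ∧ Q.z = P.z},
    (P.weight : ℕ∞)

/-- `gen` is a set of independent stabilizer generators of `C`. -/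
def IsGenerators (C : StabilizerCode n) {m : ℕ} (gen : Fin m → Pauli n) : Prop :=
  Subgroup.closure (Set.range gen) = C.stab ∧
    ∀ i, gen i ∉ Subgroup.closure (gen '' {j | j ≠ i})

/-- `C` encodes `k` logical qubits: it has `n - k` independent stabilizer generators. -/
def Encodes (C : StabilizerCode n) (k : ℕ) : Prop :=
  ∃ (m : ℕ) (gen : Fin m → Pauli n), C.IsGenerators gen ∧ m + k = n

/-- `X j, Z j` are logical Pauli observables of `C` which satisfy the relations of the Pauli `X`
and `Z` operators of `k` independent qubits. -/
def IsLogicalFamily (C : StabilizerCode n) {k : ℕ} (X Z : Fin k → Pauli n) : Prop :=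
  (∀ i, X i ∈ C.logicalPaulis ∧ (X i).IsObservable) ∧
  (∀ i, Z i ∈ C.logicalPaulis ∧ (Z i).IsObservable) ∧
  (∀ i j, Commute (X i) (X j)) ∧
  (∀ i j, Commute (Z i) (Z j)) ∧
  (∀ i, (X i).AntiCommute (Z i)) ∧
  (∀ i j, i ≠ j → Commute (X i) (Z j))

/-- A complete choice of logical operators `X_L^(j), Z_L^(j)` for all encoded qubits of `C`. -/
def IsLogicalBasis (C : StabilizerCode n) {k : ℕ} (X Z : Fin k → Pauli n) : Prop :=
  C.Encodes k ∧ C.IsLogicalFamily X Z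

/-- `W` is (a unitary of the Hilbert space acting on the code space of `C` as) a Clifford operator
on `C`: it preserves the code space and its action there normalizes the logical Pauli group. -/
def IsClifford (C : StabilizerCode n) (W : QubitOp n) : Prop :=
  W ∈ Matrix.unitaryGroup (Fin n → ZMod 2) ℂ ∧
  (∀ ψ ∈ C.codeSpace, W *ᵥ ψ ∈ C.codeSpace) ∧
  ∀ L ∈ C.logicalPaulis, ∃ L' ∈ C.logicalPaulis, ∀ ψ ∈ C.codeSpace,
    W *ᵥ (L.toMatrix *ᵥ ψ) = L'.toMatrix *ᵥ (W *ᵥ ψ)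

/-- `ρ` is a density operator supported on the code space of `C`. -/
def IsState (C : StabilizerCode n) (ρ : QubitOp n) : Prop :=
  ρ.PosSemidef ∧ ρ.trace = 1 ∧ ∀ v, ρ *ᵥ v ∈ C.codeSpace

/-- The process `Φ` induces the operator `W` on `C` (a global phase of `W` is immaterial). -/
def Induces (C : StabilizerCode n) (Φ : QubitOp n → QubitOp n) (W : QubitOp n) : Prop :=
  ∀ ρ, C.IsState ρ → Φ ρ = W * ρ * Wᴴ

end StabilizerCode

/-- The process "measure the observable `g`, and apply `h` if the outcome is `-1`", as a map of
density operators (averaged over the two outcomes, whose projections are `(1 ± g) / 2`). -/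
noncomputable def measureCorrect {n : ℕ} (g h : Pauli n) (ρ : QubitOp n) : QubitOp n :=
  let pos : QubitOp n := (1 / 2 : ℂ) • (1 + g.toMatrix)
  let neg : QubitOp n := (1 / 2 : ℂ) • (1 - g.toMatrix)
  pos * ρ * pos + h.toMatrix * (neg * ρ * neg) * (h.toMatrix)ᴴ

/-- The data of an elementary code rewiring of a code with `m` stabilizer generators: the generator
to be rewired, and two Pauli operators `g`, `g'`. -/
structure Rewiring (n m : ℕ) where
  idx : Fin m
  g : Pauli n
  g' : Pauli n

namespace Rewiring

variable {n m k : ℕ}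

/-- `(g, g')` is a code rewiring pair, for the stabilizer generators `gen` and the logical
operators `X`, `Z`. -/
def IsRewiringPair (R : Rewiring n m) (gen : Fin m → Pauli n) (X Z : Fin k → Pauli n) : Prop :=
  R.g.IsObservable ∧ R.g'.IsObservable ∧
  ((∀ j, j ≠ R.idx → Commute R.g (gen j)) ∧ R.g.AntiCommute (gen R.idx)) ∧
  (∀ j, Commute R.g (X j) ∧ Commute R.g (Z j)) ∧
  ((∀ j, j ≠ R.idx → Commute R.g' (gen j)) ∧ R.g'.AntiCommute (gen R.idx)) ∧
  R.g.AntiCommute R.g'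

/-- The elementary code rewiring: measure `g` and correct by the generator, measure `g'` and
correct by `g`, measure the generator and correct by `g'`. -/
noncomputable def process (R : Rewiring n m) (gen : Fin m → Pauli n) (ρ : QubitOp n) : QubitOp n :=
  measureCorrect (gen R.idx) R.g' (measureCorrect R.g' R.g (measureCorrect R.g (gen R.idx) ρ))

/-- The group generated by the stabilizer generators after `gen R.idx` has been replaced by `h`. -/
def replacedStab (R : Rewiring n m) (gen : Fin m → Pauli n) (h : Pauli n) : Subgroup (Pauli n) :=
  Subgroup.closure (Set.range (Function.update gen R.idx h))

/-- The two intermediate codes, in which the generator `gen R.idx` is replaced by `g` and by `g'`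
respectively, are stabilizer codes of distance at least `d`. -/
def IntermediateDistanceGE (R : Rewiring n m) (gen : Fin m → Pauli n) (d : ℕ∞) : Prop :=
  (∃ C₁ : StabilizerCode n, C₁.stab = R.replacedStab gen R.g ∧ d ≤ C₁.distance) ∧
  (∃ C₂ : StabilizerCode n, C₂.stab = R.replacedStab gen R.g' ∧ d ≤ C₂.distance)

/-- A sequence of elementary code rewirings, performed from left to right. -/
noncomputable def processList (l : List (Rewiring n m)) (gen : Fin m → Pauli n) (ρ : QubitOp n) :
    QubitOp n :=
  l.foldl (fun σ R => R.process gen σ) ρ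

end Rewiring

/-- A subsystem stabilizer code on `n` qubits with `r` gauge qubits: a stabilizer code, `r` of
whose logical qubits (with Pauli operators `gaugeX j`, `gaugeZ j`) are regarded as gauge qubits. -/
structure SubsystemCode (n r : ℕ) where
  code : StabilizerCode n
  gaugeX : Fin r → Pauli n
  gaugeZ : Fin r → Pauli n
  isLogicalFamily : code.IsLogicalFamily gaugeX gaugeZ

namespace SubsystemCode

variable {n r : ℕ}

/-- The gauge group: it is generated by the phases, the stabilizers and the Pauli operators of the
gauge qubits. -/
def gaugeGroup (S : SubsystemCode n r) : Subgroup (Pauli n) :=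
  Subgroup.closure
    ({Pauli.imag n} ∪ (S.code.stab : Set (Pauli n)) ∪ Set.range S.gaugeX ∪ Set.range S.gaugeZ)

/-- `C` is obtained by fixing `s` gauge qubits: `s` independent gauge operators `f i` are added to
the stabilizer group. -/
def IsGaugeFixing (S : SubsystemCode n r) (C : StabilizerCode n) (s : ℕ) : Prop :=
  ∃ f : Fin s → Pauli n,
    (∀ i, f i ∈ S.gaugeGroup) ∧
    C.stab = S.code.stab ⊔ Subgroup.closure (Set.range f) ∧
    ∀ i, f i ∉ S.code.stab ⊔ Subgroup.closure (f '' {j | j ≠ i})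

end SubsystemCode

/-- For an operator `t` with `t ^ 2 = 1`, the square root `P₊ + i P₋`, where `P₊` and `P₋` are the
projections `(1 ± t) / 2` on the eigenspaces of `t`. -/
noncomputable def sqrtOp {n : ℕ} (t : QubitOp n) : QubitOp n :=
  (1 / 2 : ℂ) • (1 + t) + (Complex.I / 2) • (1 - t)

/-- `W` is of `√t`-type: it is either `√t` or `t √t`. -/
def IsSqrtType {n : ℕ} (t W : QubitOp n) : Prop := W = sqrtOp t ∨ W = t * sqrtOp t

/-- The `i`-th row of the parity check matrix of the `[15, 11, 3]` Hamming code, whose columns are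
the numbers `1, …, 15` in binary. -/
def hammingRow (i : Fin 4) (j : Fin 15) : ZMod 2 := if (j.val + 1).testBit i.val then 1 else 0

/-- The stabilizer group of the `[[15, 7, 3]]` quantum Hamming code. -/
def hammingStab : Subgroup (Pauli 15) :=
  Subgroup.closure
    ((Set.range fun i => Pauli.ofX (hammingRow i)) ∪ (Set.range fun i => Pauli.ofZ (hammingRow i)))

/-- The stabilizer group of the 15-qubit quantum Reed-Muller code: the generators of the quantum
Hamming code, and the `Z` operators of the pairwise products of the rows. -/
def reedMullerStab : Subgroup (Pauli 15) :=
  Subgroup.closure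
    ((Set.range fun i => Pauli.ofX (hammingRow i)) ∪ (Set.range fun i => Pauli.ofZ (hammingRow i)) ∪
      {P | ∃ i j, i < j ∧ P = Pauli.ofZ (hammingRow i * hammingRow j)})

/-!
Measuring `g`, `g'` and the generator `g_ℓ` one after another, with corrections, multiplies code
states by `(1 + g_ℓ) (1 + g') (1 + g)` up to normalization. As `g_ℓ` acts as `1` on the code and
anticommutes with `g` and `g'`, this is `(1 + K) / √2` for `K = g' g`: a logical quarter turn
(`Rewiring.IsRewiringPair.process_eq`). Conversely, fix an observable `g` that anticommutes with
`g_ℓ` and commutes with the other generators and the logical operators. Given any logical Pauli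
operator `K` with `K ^ 2 = -1`, one may multiply it by `g_ℓ`, which does not alter its action on the
code, to make it anticommute with `g`; then `g' = K g` completes a rewiring pair that induces the
quarter turn about `K` (`exists_rewiringPair`). In the intermediate codes only `g_ℓ` is replaced. If
`g_ℓ` is one of the fixed gauge operators and the group generated by the others contains the
stabilizers of the subsystem code, the intermediate codes therefore have at least its distance
(`distance_mono`).

It remains to see that logical quarter turns generate the Clifford group
(`IsClifford.exists_turns`). A quarter turn about `K` fixes the Pauli operators that commute with
`K`, and multiplies by `K` those that anticommute with it. Let `F` be the group of the logical Pauli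
operators fixed by a Clifford operator `A`, and let `u` be a logical Pauli operator outside `F`,
with image `u'` under `A`. If `u` and `u'` anticommute, the quarter turn about `u u'⁻¹` maps `u'` to
`u`, and it fixes `F` because `A` preserves commutation relations. If they commute, then the double
commutant property of the Pauli group (`Pauli.exists_antiCommute_of_notMem`), applied to `u` and to
`u'`, yields an operator `t` that commutes with `F` and anticommutes with both `u` and `u'`; a
quarter turn about `t` leads to the first case. So `F` can be enlarged until it consists of all the
logical Pauli operators, and then `A` is a scalar on the code, as is seen by averaging its
conjugates over the Pauli group (`StabilizerCode.eq_smul_proj`).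

For the Hamming and Reed–Muller codes the products of two rows of the parity check matrix serve both
as the gauge operators `Z` and, paired with the complementary products, as the gauge operators `X`.
The choice `K = X_L Z_L g_ℓ` gives the quarter turn about `Y_L`.
-/

/-! ### The Pauli group and the symplectic form -/

namespace Pauli

variable {n : ℕ}

@[simp] theorem mul_x (P Q : Pauli n) : (P * Q).x = P.x + Q.x := rfl

@[simp] theorem mul_z (P Q : Pauli n) : (P * Q).z = P.z + Q.z := rfl

theorem mul_phase (P Q : Pauli n) :
    (P * Q).phase = P.phase + Q.phase + signPhase (P.z ⬝ᵥ Q.x) := rfl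

@[simp] theorem one_x : (1 : Pauli n).x = 0 := rfl

@[simp] theorem one_z : (1 : Pauli n).z = 0 := rfl

@[simp] theorem one_phase : (1 : Pauli n).phase = 0 := rfl

@[simp] theorem inv_x (P : Pauli n) : P⁻¹.x = P.x := rfl

@[simp] theorem inv_z (P : Pauli n) : P⁻¹.z = P.z := rfl

instance : Finite (Pauli n) :=
  Finite.of_injective (fun P : Pauli n => (P.phase, P.x, P.z)) fun P Q h => by
    simp only [Prod.mk.injEq] at h
    exact Pauli.ext h.1 h.2.1 h.2.2

/-- The symplectic form on the Pauli group, which records whether two Pauli operators commute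
(value `0`) or anticommute (value `1`). -/
def symp (P Q : Pauli n) : ZMod 2 := P.z ⬝ᵥ Q.x + Q.z ⬝ᵥ P.x

theorem symp_comm (P Q : Pauli n) : symp P Q = symp Q P := add_comm _ _

@[simp] theorem symp_mul_left (P Q R : Pauli n) : symp (P * Q) R = symp P R + symp Q R := by
  simp only [symp, mul_x, mul_z, add_dotProduct, dotProduct_add]; ring

@[simp] theorem symp_mul_right (P Q R : Pauli n) : symp P (Q * R) = symp P Q + symp P R := by
  rw [symp_comm, symp_mul_left, symp_comm Q, symp_comm R]

@[simp] theorem symp_inv_left (P Q : Pauli n) : symp P⁻¹ Q = symp P Q := rfl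

@[simp] theorem symp_inv_right (P Q : Pauli n) : symp P Q⁻¹ = symp P Q := rfl

@[simp] theorem symp_self (P : Pauli n) : symp P P = 0 := CharTwo.add_self_eq_zero _

@[simp] theorem symp_imag_right (P : Pauli n) : symp P (imag n) = 0 := by simp [symp, imag]

theorem negOne_mul (P : Pauli n) : negOne n * P = ⟨P.phase + 2, P.x, P.z⟩ := by
  simp [mul_def, negOne, signPhase, add_comm]

theorem negOne_mul_negOne : negOne n * negOne n = 1 := by
  rw [negOne_mul]; ext <;> simp [negOne]; decide

theorem commute_negOne (P : Pauli n) : Commute (negOne n) P := by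
  rw [Commute, SemiconjBy, negOne_mul]
  simp [mul_def, negOne, signPhase]

theorem commute_iff {P Q : Pauli n} : Commute P Q ↔ symp P Q = 0 := by
  rw [Commute, SemiconjBy, mul_def, mul_def, symp, Pauli.mk.injEq]
  have key : ∀ a b : ZMod 2, ∀ c d : ZMod 4,
      c + d + signPhase a = d + c + signPhase b ↔ a + b = 0 := by decide
  rw [key]
  simp [add_comm]

theorem antiCommute_iff {P Q : Pauli n} : AntiCommute P Q ↔ symp P Q = 1 := by
  rw [AntiCommute, negOne_mul, mul_def, mul_def, symp, Pauli.mk.injEq]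
  have key : ∀ a b : ZMod 2, ∀ c d : ZMod 4,
      c + d + signPhase a = d + c + signPhase b + 2 ↔ a + b = 1 := by decide
  simp only [key]
  simp [add_comm]

theorem symp_eq_zero_or_one (P Q : Pauli n) : symp P Q = 0 ∨ symp P Q = 1 := by
  generalize symp P Q = a; revert a; decide

theorem mul_self (P : Pauli n) : P * P = ⟨2 * P.phase + signPhase (P.z ⬝ᵥ P.x), 0, 0⟩ := by
  rw [mul_def, two_mul]
  congr 1 <;> exact funext fun j => CharTwo.add_self_eq_zero _

theorem mul_self_eq (P : Pauli n) : P * P = 1 ∨ P * P = negOne n := by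
  rw [mul_self, one_def, negOne]
  simp only [Pauli.mk.injEq, and_true]
  generalize P.phase = c; generalize P.z ⬝ᵥ P.x = a
  revert a c; decide

/-- Multiplication by a phase turns any Pauli operator into an observable. -/
theorem exists_observable (P : Pauli n) :
    ∃ Q : Pauli n, Q.IsObservable ∧ Q.x = P.x ∧ Q.z = P.z := by
  have key : ∀ a : ZMod 2, ∃ c : ZMod 4, 2 * c + signPhase a = 0 := by decide
  obtain ⟨c, hc⟩ := key (P.z ⬝ᵥ P.x)
  exact ⟨⟨c, P.x, P.z⟩, by rw [IsObservable, mul_self, one_def]; simp [hc], rfl, rfl⟩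

/-- Multiplication by a phase turns any Pauli operator into an anti-Hermitian one. -/
theorem exists_mul_self_eq_negOne (P : Pauli n) :
    ∃ Q : Pauli n, Q * Q = negOne n ∧ Q.x = P.x ∧ Q.z = P.z := by
  have key : ∀ a : ZMod 2, ∃ c : ZMod 4, 2 * c + signPhase a = 2 := by decide
  obtain ⟨c, hc⟩ := key (P.z ⬝ᵥ P.x)
  exact ⟨⟨c, P.x, P.z⟩, by rw [mul_self, negOne]; simp [hc], rfl, rfl⟩

theorem symp_congr_left {P Q : Pauli n} (hx : P.x = Q.x) (hz : P.z = Q.z) (R : Pauli n) :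
    symp P R = symp Q R := by rw [symp, symp, hx, hz]

theorem imag_mul (P : Pauli n) : imag n * P = ⟨P.phase + 1, P.x, P.z⟩ := by
  simp [mul_def, imag, signPhase, add_comm]

theorem imag_mul_imag : imag n * imag n = negOne n := by
  rw [imag_mul]; ext <;> simp [negOne, imag]; decide

theorem imag_pow_mul (k : ℕ) (P : Pauli n) : imag n ^ k * P = ⟨P.phase + k, P.x, P.z⟩ := by
  induction k with
  | zero => simp
  | succ k ih =>
    rw [pow_succ', mul_assoc, ih, imag_mul]
    push_cast; rw [add_assoc]

/-- Operators that agree up to a phase lie in the same subgroups that contain the phases. -/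
theorem mem_of_phase {F : Subgroup (Pauli n)} (hF : imag n ∈ F) {P Q : Pauli n} (hQ : Q ∈ F)
    (hx : Q.x = P.x) (hz : Q.z = P.z) : P ∈ F := by
  have : P = imag n ^ (P.phase - Q.phase).val * Q := by
    rw [imag_pow_mul]; ext <;> simp [hx, hz]
  rw [this]
  exact F.mul_mem (F.pow_mem hF _) hQ

/-- Double commutant property of the Pauli group: an operator outside a subgroup that contains the
phases is detected by an operator commuting with the subgroup. This is the nondegeneracy of the
symplectic form. -/
theorem exists_antiCommute_of_notMem {F : Subgroup (Pauli n)} (hF : imag n ∈ F) {u : Pauli n}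
    (hu : u ∉ F) : ∃ t : Pauli n, (∀ f ∈ F, symp t f = 0) ∧ symp t u = 1 := by
  classical
  let A : AddSubgroup ((Fin n → ZMod 2) × (Fin n → ZMod 2)) :=
    { carrier := {v | ∃ P ∈ F, P.x = v.1 ∧ P.z = v.2}
      add_mem' := by
        rintro _ _ ⟨P, hP, hx, hz⟩ ⟨Q, hQ, hx', hz'⟩
        exact ⟨P * Q, F.mul_mem hP hQ, by simp [hx, hx'], by simp [hz, hz']⟩
      zero_mem' := ⟨1, F.one_mem, rfl, rfl⟩
      neg_mem' := by
        rintro v ⟨P, hP, hx, hz⟩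
        exact ⟨P, hP, by simp [hx, ZModModule.neg_eq_self], by simp [hz, ZModModule.neg_eq_self]⟩ }
  let p : Submodule (ZMod 2) ((Fin n → ZMod 2) × (Fin n → ZMod 2)) := A.toZModSubmodule 2
  have hup : (u.x, u.z) ∉ p := by
    rintro ⟨P, hP, hx, hz⟩
    exact hu (mem_of_phase hF hP hx hz)
  obtain ⟨f, hfu, hfp⟩ := Submodule.exists_le_ker_of_notMem hup
  let t : Pauli n := ⟨0, fun j => f (0, Pi.single j 1), fun j => f (Pi.single j 1, 0)⟩
  have ht : ∀ P : Pauli n, symp t P = f (P.x, P.z) := by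
    intro P
    have h1 : f (P.x, 0) = t.z ⬝ᵥ P.x := by
      have := (f.comp (LinearMap.inl _ _ _)).pi_apply_eq_sum_univ P.x
      simp only [LinearMap.comp_apply, LinearMap.inl_apply] at this
      rw [this, dotProduct]
      refine Finset.sum_congr rfl fun j _ => ?_
      rw [smul_eq_mul, mul_comm]
      congr 3
      ext i; simp [Pi.single_apply, eq_comm]
    have h2 : f (0, P.z) = P.z ⬝ᵥ t.x := by
      have := (f.comp (LinearMap.inr _ _ _)).pi_apply_eq_sum_univ P.z
      simp only [LinearMap.comp_apply, LinearMap.inr_apply] at this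
      rw [this, dotProduct]
      refine Finset.sum_congr rfl fun j _ => ?_
      rw [smul_eq_mul]
      congr 3
      ext i; simp [Pi.single_apply, eq_comm]
    rw [symp, ← h1, ← h2, ← map_add]; simp
  refine ⟨t, fun P hP => ?_, ?_⟩
  · rw [ht]; exact hfp ⟨P, hP, rfl, rfl⟩
  · have key : ∀ a : ZMod 2, a ≠ 0 → a = 1 := by decide
    exact key _ (by rwa [ht])

end Pauli

/-! ### The operators on the Hilbert space -/

theorem matX_mul_matX {n : ℕ} (u v : Fin n → ZMod 2) : matX u * matX v = matX (u + v) := by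
  ext a b
  simp only [matX, Matrix.mul_apply, Matrix.of_apply, mul_ite, mul_one, mul_zero,
    Finset.sum_ite_eq', Finset.mem_univ, if_true]
  congr 1
  rw [add_assoc, add_comm v u]

theorem neg_one_pow_val_add (a b : ZMod 2) :
    (-1 : ℂ) ^ (a + b).val = (-1) ^ a.val * (-1) ^ b.val := by
  revert a b
  have : ∀ a b : ZMod 2, (-1 : ℤ) ^ (a + b).val = (-1) ^ a.val * (-1) ^ b.val := by decide
  intro a b; exact_mod_cast this a b

theorem matZ_mul_matZ {n : ℕ} (u v : Fin n → ZMod 2) : matZ u * matZ v = matZ (u + v) := by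
  simp only [matZ, Matrix.diagonal_mul_diagonal, add_dotProduct, neg_one_pow_val_add]

theorem matZ_mul_matX {n : ℕ} (u v : Fin n → ZMod 2) :
    matZ u * matX v = ((-1 : ℂ) ^ (u ⬝ᵥ v).val) • (matX v * matZ u) := by
  ext a b
  simp only [matX, matZ, Matrix.diagonal_mul, Matrix.mul_diagonal, Matrix.of_apply,
    Matrix.smul_apply, smul_eq_mul]
  split_ifs with h
  · rw [h, dotProduct_add, neg_one_pow_val_add]; ring
  · ring

theorem matX_zero {n : ℕ} : matX (0 : Fin n → ZMod 2) = 1 := by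
  ext a b; simp [matX, Matrix.one_apply]

theorem matZ_zero {n : ℕ} : matZ (0 : Fin n → ZMod 2) = 1 := by
  ext a b; simp [matZ]

theorem conjTranspose_matX {n : ℕ} (v : Fin n → ZMod 2) : (matX v)ᴴ = matX v := by
  ext a b
  simp only [matX, Matrix.conjTranspose_apply, Matrix.of_apply]
  have : b = a + v ↔ a = b + v := by
    constructor <;> rintro rfl <;> ext j <;> simp [add_assoc, CharTwo.add_self_eq_zero]
  simp [this, apply_ite]

theorem conjTranspose_matZ {n : ℕ} (v : Fin n → ZMod 2) : (matZ v)ᴴ = matZ v := by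
  rw [matZ, Matrix.diagonal_conjTranspose]
  congr 1; ext w; simp

theorem I_pow_val_add (a b : ZMod 4) :
    Complex.I ^ (a + b).val = Complex.I ^ a.val * Complex.I ^ b.val := by
  rw [ZMod.val_add, ← pow_add]
  conv_rhs => rw [← Nat.div_add_mod (a.val + b.val) 4, pow_add, pow_mul, Complex.I_pow_four]
  simp

theorem I_pow_signPhase (a : ZMod 2) :
    Complex.I ^ (Pauli.signPhase a).val = (-1) ^ a.val := by
  have : ∀ a : ZMod 2, (Pauli.signPhase a).val = 2 * a.val := by decide
  rw [this, pow_mul, Complex.I_sq]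

namespace Pauli

variable {n : ℕ}

theorem toMatrix_mul (P Q : Pauli n) : (P * Q).toMatrix = P.toMatrix * Q.toMatrix := by
  have : matX P.x * matZ P.z * (matX Q.x * matZ Q.z) =
      ((-1 : ℂ) ^ (P.z ⬝ᵥ Q.x).val) • (matX (P.x + Q.x) * matZ (P.z + Q.z)) := by
    calc _ = matX P.x * (matZ P.z * matX Q.x) * matZ Q.z := by simp only [Matrix.mul_assoc]
      _ = _ := by
        rw [matZ_mul_matX, ← matX_mul_matX, ← matZ_mul_matZ]
        simp only [Matrix.mul_assoc, Matrix.mul_smul, Matrix.smul_mul]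
  simp only [toMatrix, Matrix.smul_mul, Matrix.mul_smul, smul_smul, this, mul_def,
    I_pow_val_add, I_pow_signPhase]
  congr 1; ring

@[simp] theorem toMatrix_one : (1 : Pauli n).toMatrix = 1 := by
  simp [toMatrix, matX_zero, matZ_zero]

@[simp] theorem toMatrix_imag : (imag n).toMatrix = Complex.I • 1 := by
  have : (1 : ZMod 4).val = 1 := rfl
  simp [toMatrix, matX_zero, matZ_zero, imag, this]

@[simp] theorem toMatrix_negOne : (negOne n).toMatrix = -1 := by
  rw [← imag_mul_imag, toMatrix_mul]; simp [smul_smul]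

theorem toMatrix_inv_mul (P : Pauli n) : P⁻¹.toMatrix * P.toMatrix = 1 := by
  rw [← toMatrix_mul]; simp

theorem toMatrix_mul_inv (P : Pauli n) : P.toMatrix * P⁻¹.toMatrix = 1 := by
  rw [← toMatrix_mul]; simp

theorem conjTranspose_toMatrix (P : Pauli n) : P.toMatrixᴴ = P⁻¹.toMatrix := by
  have h : P.toMatrixᴴ * P.toMatrix = 1 := by
    have hI : (star (Complex.I ^ P.phase.val)) * Complex.I ^ P.phase.val = 1 := by
      rw [star_pow, ← mul_pow]; simp
    have hz : matZ P.z * matZ P.z = 1 := by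
      rw [matZ_mul_matZ, ← matZ_zero]; congr 1; exact funext fun _ => CharTwo.add_self_eq_zero _
    have hx : matX P.x * matX P.x = 1 := by
      rw [matX_mul_matX, ← matX_zero]; congr 1; exact funext fun _ => CharTwo.add_self_eq_zero _
    simp only [toMatrix, Matrix.conjTranspose_smul, Matrix.conjTranspose_mul, conjTranspose_matX,
      conjTranspose_matZ, Matrix.smul_mul, Matrix.mul_smul, smul_smul]
    rw [mul_comm, hI, one_smul, Matrix.mul_assoc, ← Matrix.mul_assoc (matX _), hx, Matrix.one_mul,
      hz]
  calc _ = P.toMatrixᴴ * (P.toMatrix * P⁻¹.toMatrix) := by rw [toMatrix_mul_inv, Matrix.mul_one]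
    _ = _ := by rw [← Matrix.mul_assoc, h, Matrix.one_mul]

theorem toMatrix_mul_comm {P Q : Pauli n} (h : symp P Q = 0) :
    P.toMatrix * Q.toMatrix = Q.toMatrix * P.toMatrix := by
  rw [← toMatrix_mul, ← toMatrix_mul, (commute_iff.mpr h).eq]

theorem toMatrix_mul_anticomm {P Q : Pauli n} (h : symp P Q = 1) :
    P.toMatrix * Q.toMatrix = -(Q.toMatrix * P.toMatrix) := by
  have := congrArg toMatrix (antiCommute_iff.mpr h : P * Q = negOne n * (Q * P))
  simpa [toMatrix_mul] using this

theorem symp_ofX_right (P : Pauli n) (v : Fin n → ZMod 2) : symp P (ofX v) = P.z ⬝ᵥ v := by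
  simp [symp, ofX]

theorem symp_ofZ_right (P : Pauli n) (v : Fin n → ZMod 2) : symp P (ofZ v) = v ⬝ᵥ P.x := by
  simp [symp, ofZ]

theorem trace_toMatrix_eq_zero {P : Pauli n} (h : P.x ≠ 0 ∨ P.z ≠ 0) : P.toMatrix.trace = 0 := by
  have : ∃ Q : Pauli n, symp P Q = 1 := by
    have key : ∀ a : ZMod 2, a ≠ 0 → a = 1 := by decide
    rcases h with h | h <;> obtain ⟨j, hj⟩ := Function.ne_iff.mp h
    · exact ⟨ofZ (Pi.single j 1), by rw [symp_ofZ_right]; simpa using key _ hj⟩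
    · exact ⟨ofX (Pi.single j 1), by rw [symp_ofX_right]; simpa using key _ hj⟩
  obtain ⟨Q, hQ⟩ := this
  have h1 : P.toMatrix.trace = -P.toMatrix.trace := by
    calc P.toMatrix.trace = (P.toMatrix * Q.toMatrix * Q⁻¹.toMatrix).trace := by
          rw [Matrix.mul_assoc, toMatrix_mul_inv, Matrix.mul_one]
      _ = -(Q.toMatrix * P.toMatrix * Q⁻¹.toMatrix).trace := by
          rw [toMatrix_mul_anticomm hQ, Matrix.neg_mul, Matrix.trace_neg]
      _ = _ := by rw [Matrix.trace_mul_comm, ← Matrix.mul_assoc, toMatrix_inv_mul, Matrix.one_mul]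
  exact self_eq_neg.mp h1

end Pauli

/-- The Pauli operators act irreducibly: an operator that commutes with all of them is a scalar. -/
theorem eq_smul_one_of_commute_pauli {n : ℕ} {A : QubitOp n}
    (hA : ∀ P : Pauli n, P.toMatrix * A = A * P.toMatrix) : ∃ c : ℂ, A = c • 1 := by
  have hX : ∀ v : Fin n → ZMod 2, matX v * A = A * matX v := fun v => by
    simpa [Pauli.toMatrix, Pauli.ofX, matZ_zero] using hA (Pauli.ofX v)
  have hZ : ∀ v : Fin n → ZMod 2, matZ v * A = A * matZ v := fun v => by
    simpa [Pauli.toMatrix, Pauli.ofZ, matX_zero] using hA (Pauli.ofZ v)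
  refine ⟨A 0 0, ?_⟩
  ext a b
  by_cases hab : a = b
  · subst hab
    have h := congrFun (congrFun (hX a) a) 0
    simp only [matX, Matrix.mul_apply, Matrix.of_apply, ite_mul, mul_ite, one_mul, mul_one,
      zero_mul, mul_zero, zero_add] at h
    have e : ∀ x : Fin n → ZMod 2, a = x + a ↔ x = 0 := fun x => by
      constructor
      · intro h; exact left_eq_add.mp (by rw [add_comm] at h; exact h)
      · rintro rfl; simp
    simp only [e, Finset.sum_ite_eq', Finset.mem_univ, if_true] at h
    simp [h]
  · obtain ⟨j, hj⟩ := Function.ne_iff.mp hab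
    have h := congrFun (congrFun (hZ (Pi.single j 1)) a) b
    simp only [matZ, Matrix.diagonal_mul, Matrix.mul_diagonal, single_one_dotProduct] at h
    have key : ∀ x y : ZMod 2, x ≠ y → (-1 : ℤ) ^ x.val = -(-1) ^ y.val := by decide
    have h2 : (-1 : ℂ) ^ (a j).val = -(-1) ^ (b j).val := by exact_mod_cast key _ _ hj
    rw [h2] at h
    have h3 : (-1 : ℂ) ^ (b j).val ≠ 0 := by simp
    have h4 : (-1 : ℂ) ^ (b j).val * A a b = 0 := by linear_combination (-1 / 2 : ℂ) * h
    simpa [hab, h3] using h4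

theorem Matrix.eq_zero_of_eq_neg {m : Type*} {A : Matrix m m ℂ} (h : A = -A) : A = 0 := by
  ext i j
  exact self_eq_neg.mp (congrFun (congrFun h i) j)

/-! ### The projection on the code space -/

namespace StabilizerCode

variable {n : ℕ}

open Pauli

noncomputable instance (C : StabilizerCode n) : Fintype C.stab := Fintype.ofFinite _

theorem symp_stab (C : StabilizerCode n) {P Q : Pauli n} (hP : P ∈ C.stab) (hQ : Q ∈ C.stab) :
    symp P Q = 0 := commute_iff.mp (C.comm P hP Q hQ)

theorem mem_logicalPaulis_iff (C : StabilizerCode n) {P : Pauli n} :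
    P ∈ C.logicalPaulis ↔ ∀ Q ∈ C.stab, symp Q P = 0 := by
  rw [logicalPaulis, Subgroup.mem_centralizer_iff]
  exact forall₂_congr fun Q _ => commute_iff

theorem stab_le_logicalPaulis (C : StabilizerCode n) : C.stab ≤ C.logicalPaulis := fun _ hP =>
  C.mem_logicalPaulis_iff.mpr fun _ hQ => C.symp_stab hQ hP

theorem imag_mem_logicalPaulis (C : StabilizerCode n) : imag n ∈ C.logicalPaulis :=
  C.mem_logicalPaulis_iff.mpr fun _ _ => symp_imag_right _

theorem mul_self_of_mem_stab (C : StabilizerCode n) {P : Pauli n} (hP : P ∈ C.stab) :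
    P * P = 1 :=
  (mul_self_eq P).resolve_right fun h => C.negOne_notMem (h ▸ C.stab.mul_mem hP hP)

theorem inv_eq_self_of_mem_stab (C : StabilizerCode n) {P : Pauli n} (hP : P ∈ C.stab) :
    P⁻¹ = P := inv_eq_of_mul_eq_one_left (C.mul_self_of_mem_stab hP)

/-- The only phase in the stabilizer group is `1`. -/
theorem eq_one_of_mem_stab (C : StabilizerCode n) {P : Pauli n} (hP : P ∈ C.stab)
    (hx : P.x = 0) (hz : P.z = 0) : P = 1 := by
  have h := congrArg Pauli.phase (C.mul_self_of_mem_stab hP)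
  have hne : P.phase ≠ 2 := fun h2 => C.negOne_notMem (by
    rwa [show negOne n = P from Pauli.ext h2.symm hx.symm hz.symm])
  rw [mul_phase, hx, dotProduct_zero] at h
  have key : ∀ a : ZMod 4, a + a + signPhase 0 = 0 → a ≠ 2 → a = 0 := by decide
  exact Pauli.ext (key _ h hne) hx hz

/-- The orthogonal projection on the code space, as the average of the stabilizers. -/
noncomputable def proj (C : StabilizerCode n) : QubitOp n :=
  (Fintype.card C.stab : ℂ)⁻¹ • ∑ P : C.stab, (P : Pauli n).toMatrix

theorem mul_proj (C : StabilizerCode n) {P : Pauli n} (hP : P ∈ C.stab) :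
    P.toMatrix * C.proj = C.proj := by
  rw [proj, Matrix.mul_smul, Matrix.mul_sum]
  congr 1
  simp_rw [← toMatrix_mul]
  exact Fintype.sum_equiv (Equiv.mulLeft (⟨P, hP⟩ : C.stab)) _ _ fun _ => rfl

theorem proj_commute (C : StabilizerCode n) {L : Pauli n} (hL : L ∈ C.logicalPaulis) :
    L.toMatrix * C.proj = C.proj * L.toMatrix := by
  rw [proj, Matrix.mul_smul, Matrix.smul_mul, Matrix.mul_sum, Matrix.sum_mul]
  congr 1
  refine Finset.sum_congr rfl fun P _ => ?_
  exact (toMatrix_mul_comm (C.mem_logicalPaulis_iff.mp hL P P.2)).symm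

theorem proj_mul (C : StabilizerCode n) {P : Pauli n} (hP : P ∈ C.stab) :
    C.proj * P.toMatrix = C.proj := by
  rw [← C.proj_commute (C.stab_le_logicalPaulis hP), C.mul_proj hP]

theorem conjTranspose_toMatrix_of_mem_stab (C : StabilizerCode n) {P : Pauli n}
    (hP : P ∈ C.stab) : P.toMatrixᴴ = P.toMatrix := by
  rw [conjTranspose_toMatrix, C.inv_eq_self_of_mem_stab hP]

theorem conjTranspose_proj (C : StabilizerCode n) : C.projᴴ = C.proj := by
  rw [proj, Matrix.conjTranspose_smul, Matrix.conjTranspose_sum]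
  congr 1
  · simp
  · exact Finset.sum_congr rfl fun P _ => C.conjTranspose_toMatrix_of_mem_stab P.2

theorem card_ne_zero (C : StabilizerCode n) : (Fintype.card C.stab : ℂ) ≠ 0 :=
  Nat.cast_ne_zero.mpr Fintype.card_ne_zero

theorem proj_mul_proj (C : StabilizerCode n) : C.proj * C.proj = C.proj := by
  conv_lhs => enter [1]; rw [proj]
  rw [Matrix.smul_mul, Matrix.sum_mul]
  have : ∀ P ∈ (Finset.univ : Finset C.stab), (P : Pauli n).toMatrix * C.proj = C.proj :=
    fun P _ => C.mul_proj P.2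
  rw [Finset.sum_congr rfl this, Finset.sum_const, Finset.card_univ, ← Nat.cast_smul_eq_nsmul ℂ,
    smul_smul, inv_mul_cancel₀ C.card_ne_zero, one_smul]

/-- The trace of the projection counts only the identity, the other stabilizers being traceless. -/
theorem proj_ne_zero (C : StabilizerCode n) : C.proj ≠ 0 := by
  intro h
  have ht : C.proj.trace ≠ 0 := by
    rw [proj, Matrix.trace_smul, Matrix.trace_sum,
      Finset.sum_eq_single (1 : C.stab) (fun P _ hP => ?_) (by simp)]
    · simp
    · refine trace_toMatrix_eq_zero ?_
      by_contra! hc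
      exact hP (Subtype.ext (C.eq_one_of_mem_stab P.2 hc.1 hc.2))
  exact ht (by rw [h, Matrix.trace_zero])

theorem mem_codeSpace_iff (C : StabilizerCode n) {ψ : (Fin n → ZMod 2) → ℂ} :
    ψ ∈ C.codeSpace ↔ C.proj *ᵥ ψ = ψ := by
  constructor
  · intro h
    have h' : ∀ P : C.stab, (P : Pauli n).toMatrix *ᵥ ψ = ψ := fun P => h P P.2
    rw [proj, Matrix.smul_mulVec, Matrix.sum_mulVec]
    simp only [h', Finset.sum_const, Finset.card_univ]
    rw [← Nat.cast_smul_eq_nsmul ℂ, smul_smul, inv_mul_cancel₀ C.card_ne_zero, one_smul]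
  · intro h P hP
    rw [← h, Matrix.mulVec_mulVec, C.mul_proj hP]

theorem proj_mulVec_mem (C : StabilizerCode n) (v : (Fin n → ZMod 2) → ℂ) :
    C.proj *ᵥ v ∈ C.codeSpace := by
  rw [mem_codeSpace_iff, Matrix.mulVec_mulVec, proj_mul_proj]

theorem IsState.proj_mul {C : StabilizerCode n} {ρ : QubitOp n} (hρ : C.IsState ρ) :
    C.proj * ρ = ρ := by
  refine Matrix.ext_of_mulVec_single fun i => ?_
  rw [← Matrix.mulVec_mulVec]
  exact C.mem_codeSpace_iff.mp (hρ.2.2 _)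

theorem IsState.mul_proj {C : StabilizerCode n} {ρ : QubitOp n} (hρ : C.IsState ρ) :
    ρ * C.proj = ρ := by
  have h := congrArg Matrix.conjTranspose hρ.proj_mul
  rwa [Matrix.conjTranspose_mul, conjTranspose_proj, hρ.1.isHermitian.eq] at h

/-- A code whose stabilizer group contains that of another code has at least its distance. -/
theorem distance_mono {C D : StabilizerCode n} (h : C.stab ≤ D.stab) :
    C.distance ≤ D.distance := by
  refine le_iInf₂ fun P hP => ?_
  refine iInf₂_le P ⟨?_, ?_⟩
  · exact C.mem_logicalPaulis_iff.mpr fun Q hQ => D.mem_logicalPaulis_iff.mp hP.1 Q (h hQ)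
  · rintro ⟨Q, hQ, hx⟩
    exact hP.2 ⟨Q, h hQ, hx⟩

/-! ### Clifford operators and logical quarter turns -/

/-- The Clifford property of `A`, expressed through the projection on the code space. -/
structure ActsAsClifford (C : StabilizerCode n) (A : QubitOp n) : Prop where
  star_mul : Aᴴ * A = 1
  preserves : C.proj * (A * C.proj) = A * C.proj
  normalizes : ∀ L ∈ C.logicalPaulis, ∃ L' ∈ C.logicalPaulis,
    A * (L.toMatrix * C.proj) = L'.toMatrix * (A * C.proj)

theorem IsClifford.actsAsClifford {C : StabilizerCode n} {W : QubitOp n} (hW : C.IsClifford W) :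
    C.ActsAsClifford W where
  star_mul := Matrix.mem_unitaryGroup_iff'.mp hW.1
  preserves := by
    refine Matrix.ext_of_mulVec_single fun i => ?_
    rw [← Matrix.mulVec_mulVec, ← Matrix.mulVec_mulVec]
    exact C.mem_codeSpace_iff.mp (hW.2.1 _ (C.proj_mulVec_mem _))
  normalizes L hL := by
    obtain ⟨L', hL', h⟩ := hW.2.2 L hL
    refine ⟨L', hL', Matrix.ext_of_mulVec_single fun i => ?_⟩
    have := h _ (C.proj_mulVec_mem (Pi.single i 1))
    simpa only [Matrix.mulVec_mulVec, Matrix.mul_assoc] using this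

theorem ActsAsClifford.mul_proj_ne_zero {C : StabilizerCode n} {A : QubitOp n}
    (hA : C.ActsAsClifford A) : A * C.proj ≠ 0 := fun h => C.proj_ne_zero <| by
  rw [← Matrix.one_mul C.proj, ← hA.star_mul, Matrix.mul_assoc, h, Matrix.mul_zero]

end StabilizerCode

/-- The operator `(1 + K) / √2`; for a Pauli operator `K` with `K ^ 2 = -1` this is the rotation
by a quarter turn about the observable `-i K`. -/
noncomputable def quarterTurn {n : ℕ} (K : Pauli n) : QubitOp n :=
  ((Real.sqrt 2 : ℂ)⁻¹) • (1 + K.toMatrix)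

namespace StabilizerCode

variable {n : ℕ}

open Pauli

theorem inv_sqrt_two_mul_self : ((Real.sqrt 2 : ℂ)⁻¹) * (Real.sqrt 2 : ℂ)⁻¹ = 1 / 2 := by
  rw [← mul_inv, ← Complex.ofReal_mul, Real.mul_self_sqrt (by norm_num)]; norm_num

theorem inv_eq_of_mul_self_eq_negOne {K : Pauli n} (hK : K * K = negOne n) :
    K⁻¹ = negOne n * K := by
  rw [inv_eq_iff_mul_eq_one, (commute_negOne K).eq, ← mul_assoc, hK, negOne_mul_negOne]

theorem toMatrix_mul_self_of_negOne {K : Pauli n} (hK : K * K = negOne n) :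
    K.toMatrix * K.toMatrix = -1 := by
  rw [← toMatrix_mul, hK, toMatrix_negOne]

theorem star_quarterTurn_mul {K : Pauli n} (hK : K * K = negOne n) :
    (quarterTurn K)ᴴ * quarterTurn K = 1 := by
  have h1 : K.toMatrixᴴ = -K.toMatrix := by
    rw [conjTranspose_toMatrix, inv_eq_of_mul_self_eq_negOne hK, toMatrix_mul]; simp
  have h2 := toMatrix_mul_self_of_negOne hK
  have h3 : star ((Real.sqrt 2 : ℂ)⁻¹) = (Real.sqrt 2 : ℂ)⁻¹ := by simp
  rw [quarterTurn, Matrix.conjTranspose_smul, h3, Matrix.conjTranspose_add,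
    Matrix.conjTranspose_one, h1, Matrix.smul_mul, Matrix.mul_smul, smul_smul,
    inv_sqrt_two_mul_self]
  have : (1 + -K.toMatrix) * (1 + K.toMatrix) = (2 : ℂ) • 1 := by
    rw [two_smul]
    calc _ = 1 - K.toMatrix * K.toMatrix := by noncomm_ring
      _ = _ := by rw [h2]; noncomm_ring
  rw [this, smul_smul]; norm_num

theorem quarterTurn_commute {K L : Pauli n} (h : symp K L = 0) :
    quarterTurn K * L.toMatrix = L.toMatrix * quarterTurn K := by
  rw [quarterTurn, Matrix.smul_mul, Matrix.mul_smul, add_mul, mul_add, toMatrix_mul_comm h]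
  simp

/-- Conjugation by the quarter turn about `K` multiplies by `K` the operators that anticommute with
`K`. -/
theorem quarterTurn_mul {K L : Pauli n} (hK : K * K = negOne n) (h : symp K L = 1) :
    quarterTurn K * L.toMatrix = (K * L).toMatrix * quarterTurn K := by
  have h2 := toMatrix_mul_self_of_negOne hK
  rw [quarterTurn, Matrix.smul_mul, Matrix.mul_smul, toMatrix_mul]
  congr 1
  have h3 : K.toMatrix * L.toMatrix * K.toMatrix = L.toMatrix := by
    rw [toMatrix_mul_anticomm h, neg_mul, mul_assoc, h2]; simp
  rw [mul_add, h3]; noncomm_ring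

theorem quarterTurn_proj (C : StabilizerCode n) {K : Pauli n} (hK : K ∈ C.logicalPaulis) :
    quarterTurn K * C.proj = C.proj * quarterTurn K := by
  rw [quarterTurn, Matrix.smul_mul, Matrix.mul_smul, add_mul, mul_add, C.proj_commute hK]
  simp

/-- The operators generated by the quarter turns about logical Pauli operators. -/
def turns (C : StabilizerCode n) : Submonoid (QubitOp n) :=
  Submonoid.closure {V | ∃ K ∈ C.logicalPaulis, K * K = negOne n ∧ V = quarterTurn K}

theorem quarterTurn_mem_turns {C : StabilizerCode n} {K : Pauli n} (hK : K ∈ C.logicalPaulis)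
    (hK2 : K * K = negOne n) : quarterTurn K ∈ C.turns :=
  Submonoid.subset_closure ⟨K, hK, hK2, rfl⟩

theorem turns_proj {C : StabilizerCode n} {V : QubitOp n} (hV : V ∈ C.turns) :
    V * C.proj = C.proj * V := by
  induction hV using Submonoid.closure_induction with
  | mem V h => obtain ⟨K, hK, -, rfl⟩ := h; exact C.quarterTurn_proj hK
  | one => simp
  | mul V W _ _ hV hW => rw [mul_assoc, hW, ← mul_assoc, hV, mul_assoc]

theorem star_turns_mul {C : StabilizerCode n} {V : QubitOp n} (hV : V ∈ C.turns) :
    Vᴴ * V = 1 := by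
  induction hV using Submonoid.closure_induction with
  | mem V h => obtain ⟨K, -, hK, rfl⟩ := h; exact star_quarterTurn_mul hK
  | one => simp
  | mul V W _ _ hV hW =>
    rw [Matrix.conjTranspose_mul, mul_assoc, ← mul_assoc Vᴴ, hV, one_mul, hW]

/-! ### The quarter turns generate the Clifford group -/

variable {C : StabilizerCode n} {A : QubitOp n}

/-- Pauli operators which agree on the nonzero image of the code space under `A` cannot differ by a
sign. -/
theorem ActsAsClifford.ne_neg (hA : C.ActsAsClifford A) {P : Pauli n} :
    P.toMatrix * (A * C.proj) ≠ -(P.toMatrix * (A * C.proj)) := fun h => by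
  refine hA.mul_proj_ne_zero ?_
  have h0 : P.toMatrix * (A * C.proj) = 0 := Matrix.eq_zero_of_eq_neg h
  rw [← one_mul (A * C.proj), ← toMatrix_inv_mul P, mul_assoc, h0, mul_zero]

theorem map_mul {P Q P' Q' : Pauli n} (hQ : Q ∈ C.logicalPaulis)
    (h : A * (P.toMatrix * C.proj) = P'.toMatrix * (A * C.proj))
    (h' : A * (Q.toMatrix * C.proj) = Q'.toMatrix * (A * C.proj)) :
    A * ((P * Q).toMatrix * C.proj) = (P' * Q').toMatrix * (A * C.proj) := by
  calc _ = A * (P.toMatrix * C.proj) * Q.toMatrix := by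
        rw [toMatrix_mul, mul_assoc, C.proj_commute hQ]; simp only [mul_assoc]
    _ = P'.toMatrix * (A * (Q.toMatrix * C.proj)) := by
        rw [h, C.proj_commute hQ]; simp only [mul_assoc]
    _ = _ := by rw [h', toMatrix_mul, mul_assoc]

/-- A Clifford operator preserves the commutation relations of logical Pauli operators. -/
theorem ActsAsClifford.symp_eq (hA : C.ActsAsClifford A) {P Q P' Q' : Pauli n}
    (hP : P ∈ C.logicalPaulis) (hQ : Q ∈ C.logicalPaulis)
    (h : A * (P.toMatrix * C.proj) = P'.toMatrix * (A * C.proj))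
    (h' : A * (Q.toMatrix * C.proj) = Q'.toMatrix * (A * C.proj)) :
    symp P' Q' = symp P Q := by
  have h1 := map_mul hQ h h'
  have h2 := map_mul hP h' h
  rcases symp_eq_zero_or_one P Q with e | e <;> rcases symp_eq_zero_or_one P' Q' with e' | e' <;>
    rw [e, e'] <;> exfalso
  · rw [toMatrix_mul Q P, ← toMatrix_mul_comm e, ← toMatrix_mul, h1, toMatrix_mul,
      toMatrix_mul_anticomm e', ← toMatrix_mul, neg_mul] at h2
    exact hA.ne_neg h2.symm
  · rw [toMatrix_mul P Q, toMatrix_mul_anticomm e, ← toMatrix_mul, neg_mul, mul_neg, h2,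
      toMatrix_mul P', toMatrix_mul_comm e', ← toMatrix_mul] at h1
    exact hA.ne_neg h1.symm

/-- A Clifford operator preserves the squares of logical Pauli operators. -/
theorem ActsAsClifford.mul_self_eq (hA : C.ActsAsClifford A) {P P' : Pauli n}
    (hP : P ∈ C.logicalPaulis)
    (h : A * (P.toMatrix * C.proj) = P'.toMatrix * (A * C.proj)) : P' * P' = P * P := by
  have h1 := map_mul hP h h
  rcases Pauli.mul_self_eq P with e | e <;> rcases Pauli.mul_self_eq P' with e' | e' <;>
    rw [e, e'] <;> exfalso <;> rw [e, e'] at h1 <;> refine hA.ne_neg (P := 1) ?_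
  · simpa using h1
  · simpa using h1.symm

/-- The logical Pauli operators that commute with `A` on the code space. -/
def fixedPaulis (C : StabilizerCode n) (A : QubitOp n) : Subgroup (Pauli n) where
  carrier := {P | P ∈ C.logicalPaulis ∧ A * (P.toMatrix * C.proj) = P.toMatrix * (A * C.proj)}
  mul_mem' hP hQ := ⟨mul_mem hP.1 hQ.1, map_mul hQ.1 hP.2 hQ.2⟩
  one_mem' := ⟨one_mem _, by simp⟩
  inv_mem' := fun {P} hP => ⟨inv_mem hP.1, by
    calc A * (P⁻¹.toMatrix * C.proj)
        = P⁻¹.toMatrix * (P.toMatrix * (A * C.proj)) * P⁻¹.toMatrix := by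
          rw [← mul_assoc P⁻¹.toMatrix, toMatrix_inv_mul, one_mul,
            C.proj_commute (inv_mem hP.1), mul_assoc]
      _ = P⁻¹.toMatrix * (A * C.proj) := by
          rw [← hP.2, C.proj_commute hP.1]
          simp only [mul_assoc, toMatrix_mul_inv, mul_one]⟩

theorem imag_mem_fixedPaulis : imag n ∈ C.fixedPaulis A :=
  ⟨C.imag_mem_logicalPaulis, by simp⟩

theorem ActsAsClifford.stab_le_fixedPaulis (hA : C.ActsAsClifford A) :
    C.stab ≤ C.fixedPaulis A := fun P hP =>
  ⟨C.stab_le_logicalPaulis hP, by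
    rw [C.mul_proj hP, ← hA.preserves, ← mul_assoc P.toMatrix, C.mul_proj hP]⟩

theorem ActsAsClifford.quarterTurn_mul (hA : C.ActsAsClifford A) {K : Pauli n}
    (hK : K ∈ C.logicalPaulis) (hK2 : K * K = negOne n) :
    C.ActsAsClifford (quarterTurn K * A) where
  star_mul := by
    rw [Matrix.conjTranspose_mul, mul_assoc, ← mul_assoc (quarterTurn K)ᴴ,
      star_quarterTurn_mul hK2, one_mul, hA.star_mul]
  preserves := by
    rw [mul_assoc, ← mul_assoc, ← C.quarterTurn_proj hK, mul_assoc, hA.preserves]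
  normalizes L hL := by
    obtain ⟨L', hL', h⟩ := hA.normalizes L hL
    rcases symp_eq_zero_or_one K L' with e | e
    · refine ⟨L', hL', ?_⟩
      rw [mul_assoc, h, ← mul_assoc, quarterTurn_commute e]; simp only [mul_assoc]
    · refine ⟨K * L', mul_mem hK hL', ?_⟩
      rw [mul_assoc, h, ← mul_assoc, StabilizerCode.quarterTurn_mul hK2 e]; simp only [mul_assoc]

/-- A quarter turn about an operator commuting with the fixed Pauli operators keeps them fixed. -/
theorem fixedPaulis_le_quarterTurn_mul {K : Pauli n}
    (hF : ∀ f ∈ C.fixedPaulis A, symp K f = 0) :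
    C.fixedPaulis A ≤ C.fixedPaulis (quarterTurn K * A) := fun f hf =>
  ⟨hf.1, by
    rw [mul_assoc, hf.2, ← mul_assoc, quarterTurn_commute (hF f hf)]; simp only [mul_assoc]⟩

theorem quarterTurn_mul_map {K P P' : Pauli n} (hK : K * K = negOne n) (h1 : symp K P' = 1)
    (h : A * (P.toMatrix * C.proj) = P'.toMatrix * (A * C.proj)) :
    quarterTurn K * A * (P.toMatrix * C.proj) =
      (K * P').toMatrix * (quarterTurn K * A * C.proj) := by
  rw [mul_assoc, h, ← mul_assoc, StabilizerCode.quarterTurn_mul hK h1]; simp only [mul_assoc]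

/-- If a Clifford operator sends `u` to an operator `u'` that anticommutes with `u`, then a single
quarter turn brings `u'` back to `u`. -/
theorem ActsAsClifford.exists_turn_of_anti (hA : C.ActsAsClifford A) {u u' : Pauli n}
    (hu : u ∈ C.logicalPaulis) (hu' : u' ∈ C.logicalPaulis)
    (h : A * (u.toMatrix * C.proj) = u'.toMatrix * (A * C.proj)) (huu : symp u u' = 1) :
    ∃ K ∈ C.logicalPaulis, K * K = negOne n ∧
      C.fixedPaulis A ≤ C.fixedPaulis (quarterTurn K * A) ∧
      u ∈ C.fixedPaulis (quarterTurn K * A) := by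
  have hsq : (u * u'⁻¹) * (u * u'⁻¹) = negOne n := by
    have hac : u' * u = negOne n * (u * u') := antiCommute_iff.mpr (by rwa [symp_comm])
    have h2 := hA.mul_self_eq hu h
    have h3 : u * u'⁻¹ = negOne n * (u'⁻¹ * u) := by
      rw [mul_inv_eq_iff_eq_mul]
      calc u = u'⁻¹ * (u' * u) := by group
        _ = _ := by
          rw [hac, ← mul_assoc, ← (commute_negOne _).eq]; group
    calc (u * u'⁻¹) * (u * u'⁻¹) = negOne n * (u'⁻¹ * u) * (u * u'⁻¹) := by rw [← h3]
      _ = negOne n * (u'⁻¹ * (u * u) * u'⁻¹) := by group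
      _ = _ := by rw [← h2]; group
  refine ⟨u * u'⁻¹, mul_mem hu (inv_mem hu'), hsq, ?_, hu, ?_⟩
  · refine fixedPaulis_le_quarterTurn_mul fun f hf => ?_
    rw [symp_mul_left, symp_inv_left, hA.symp_eq hu hf.1 h hf.2]
    exact CharTwo.add_self_eq_zero _
  · have := quarterTurn_mul_map hsq (by simpa using huu) h
    simpa using this

/-- A logical Pauli operator that is not fixed by a Clifford operator can be fixed, together with
all those that are, by composing with one or two quarter turns. -/
theorem ActsAsClifford.exists_turns_of_notMem (hA : C.ActsAsClifford A) {u : Pauli n}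
    (hu : u ∈ C.logicalPaulis) (huF : u ∉ C.fixedPaulis A) :
    ∃ V ∈ C.turns, C.ActsAsClifford (V * A) ∧ C.fixedPaulis A < C.fixedPaulis (V * A) := by
  obtain ⟨u', hu', h⟩ := hA.normalizes u hu
  rcases symp_eq_zero_or_one u u' with huu | huu
  swap
  · obtain ⟨K, hK, hK2, hle, hmem⟩ := hA.exists_turn_of_anti hu hu' h huu
    exact ⟨_, quarterTurn_mem_turns hK hK2, hA.quarterTurn_mul hK hK2,
      lt_of_le_of_ne hle fun e => huF (e ▸ hmem)⟩
  have hu'F : u' ∉ C.fixedPaulis A := fun hf => huF ⟨hu, by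
    have h1 : A * (u.toMatrix * C.proj) = A * (u'.toMatrix * C.proj) := h.trans hf.2.symm
    have h2 : u.toMatrix * C.proj = u'.toMatrix * C.proj := by
      have := congrArg (Aᴴ * ·) h1
      simpa only [← mul_assoc, hA.star_mul, one_mul] using this
    rw [h, ← hA.preserves, ← mul_assoc, ← mul_assoc u.toMatrix, h2]⟩
  -- One of `t₁`, `t₂` and `t₁ t₂` commutes with everything fixed, and anticommutes with both `u`
  -- and `u'`.
  obtain ⟨t, htF, htu, htu'⟩ : ∃ t : Pauli n, (∀ f ∈ C.fixedPaulis A, symp t f = 0) ∧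
      symp t u = 1 ∧ symp t u' = 1 := by
    obtain ⟨t₁, h₁, h₁u⟩ := exists_antiCommute_of_notMem imag_mem_fixedPaulis huF
    obtain ⟨t₂, h₂, h₂u⟩ := exists_antiCommute_of_notMem imag_mem_fixedPaulis hu'F
    rcases symp_eq_zero_or_one t₁ u' with e₁ | e₁
    · rcases symp_eq_zero_or_one t₂ u with e₂ | e₂
      · exact ⟨t₁ * t₂, fun f hf => by simp [h₁ f hf, h₂ f hf], by simp [h₁u, e₂],
          by simp [e₁, h₂u]⟩
      · exact ⟨t₂, h₂, e₂, h₂u⟩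
    · exact ⟨t₁, h₁, h₁u, e₁⟩
  obtain ⟨K, hK2, hx, hz⟩ := exists_mul_self_eq_negOne t
  have hKt : ∀ P, symp K P = symp t P := symp_congr_left hx hz
  have hK : K ∈ C.logicalPaulis := C.mem_logicalPaulis_iff.mpr fun Q hQ => by
    rw [symp_comm, hKt]; exact htF Q (hA.stab_le_fixedPaulis hQ)
  have hle := fixedPaulis_le_quarterTurn_mul (C := C) (A := A) (K := K) fun f hf => by
    rw [hKt]; exact htF f hf
  have hB := hA.quarterTurn_mul hK hK2
  obtain ⟨K', hK', hK'2, hle', hmem⟩ := hB.exists_turn_of_anti hu (mul_mem hK hu')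
    (quarterTurn_mul_map hK2 (by rw [hKt, htu']) h)
    (by rw [symp_mul_right, huu, symp_comm, hKt, htu, add_zero])
  refine ⟨quarterTurn K' * quarterTurn K,
    mul_mem (quarterTurn_mem_turns hK' hK'2) (quarterTurn_mem_turns hK hK2), ?_, ?_⟩
  · rw [mul_assoc]; exact hB.quarterTurn_mul hK' hK'2
  · rw [mul_assoc]
    exact lt_of_le_of_ne (hle.trans hle') fun e => huF (e ▸ hmem)

theorem ActsAsClifford.exists_turns (hA : C.ActsAsClifford A) :
    ∃ V ∈ C.turns, C.ActsAsClifford (V * A) ∧ C.logicalPaulis ≤ C.fixedPaulis (V * A) := by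
  induction hF : C.fixedPaulis A using WellFoundedGT.induction generalizing A with
  | ind F ih =>
    by_cases hle : C.logicalPaulis ≤ C.fixedPaulis A
    · exact ⟨1, one_mem _, by rwa [one_mul], by rwa [one_mul]⟩
    · obtain ⟨u, hu, huF⟩ := SetLike.not_le_iff_exists.mp hle
      obtain ⟨V, hV, hVA, hlt⟩ := hA.exists_turns_of_notMem hu huF
      obtain ⟨V', hV', h1, h2⟩ := ih _ (hF ▸ hlt) hVA rfl
      exact ⟨V' * V, mul_mem hV' hV, by rwa [mul_assoc], by rwa [mul_assoc]⟩

/-- Irreducibility of the code space under the logical Pauli operators. The average of `A` over the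
whole Pauli group is a scalar; compressed to the code space, it retains only the conjugates of `A`
by logical Pauli operators. -/
theorem eq_smul_proj (hA : C.proj * (A * C.proj) = A * C.proj)
    (hF : C.logicalPaulis ≤ C.fixedPaulis A) : ∃ c : ℂ, A * C.proj = c • C.proj := by
  classical
  have : Fintype (Pauli n) := Fintype.ofFinite _
  let B : QubitOp n := ∑ Q : Pauli n, Q.toMatrix * (A * C.proj) * Q⁻¹.toMatrix
  have hB : ∀ P : Pauli n, P.toMatrix * B = B * P.toMatrix := fun P => by
    rw [Matrix.mul_sum, Matrix.sum_mul]
    refine Fintype.sum_equiv (Equiv.mulLeft P) _ _ fun Q => ?_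
    simp only [Equiv.coe_mulLeft, mul_inv_rev, toMatrix_mul, mul_assoc]
    rw [toMatrix_inv_mul, mul_one]
  obtain ⟨c, hc⟩ := eq_smul_one_of_commute_pauli hB
  have hQ : ∀ Q : Pauli n, C.proj * (Q.toMatrix * (A * C.proj) * Q⁻¹.toMatrix) * C.proj =
      if Q ∈ C.logicalPaulis then A * C.proj else 0 := fun Q => by
    split_ifs with h
    · rw [← (hF h).2]
      calc _ = C.proj * (A * (Q.toMatrix * (C.proj * Q⁻¹.toMatrix))) * C.proj := by
            simp only [mul_assoc]
        _ = C.proj * (A * C.proj) * C.proj := by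
            rw [← C.proj_commute (inv_mem h), ← mul_assoc Q.toMatrix, toMatrix_mul_inv, one_mul]
        _ = _ := by rw [hA, mul_assoc, proj_mul_proj]
    · obtain ⟨s, hs, hsQ⟩ : ∃ s ∈ C.stab, symp s Q = 1 := by
        by_contra! hcon
        exact h (C.mem_logicalPaulis_iff.mpr fun s hs =>
          (symp_eq_zero_or_one s Q).resolve_right (hcon s hs))
      have h0 : C.proj * Q.toMatrix * C.proj = 0 := by
        refine Matrix.eq_zero_of_eq_neg ?_
        calc C.proj * Q.toMatrix * C.proj = C.proj * s.toMatrix * Q.toMatrix * C.proj := by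
              rw [C.proj_mul hs]
          _ = -(C.proj * Q.toMatrix * (s.toMatrix * C.proj)) := by
              rw [mul_assoc C.proj, toMatrix_mul_anticomm hsQ]; noncomm_ring
          _ = _ := by rw [C.mul_proj hs]
      calc _ = C.proj * Q.toMatrix * C.proj * (A * C.proj) * Q⁻¹.toMatrix * C.proj := by
            conv_lhs => rw [← hA]
            simp only [mul_assoc]
        _ = 0 := by rw [h0]; simp
  have hsum : C.proj * B * C.proj =
      ((Finset.univ.filter (· ∈ C.logicalPaulis)).card : ℂ) • (A * C.proj) := by
    rw [Matrix.mul_sum, Matrix.sum_mul, Finset.sum_congr rfl fun Q _ => hQ Q, ← Finset.sum_filter,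
      Finset.sum_const, Nat.cast_smul_eq_nsmul]
  have hcard : ((Finset.univ.filter (· ∈ C.logicalPaulis)).card : ℂ) ≠ 0 :=
    Nat.cast_ne_zero.mpr (Finset.card_ne_zero_of_mem
      (Finset.mem_filter.mpr ⟨Finset.mem_univ _, one_mem _⟩))
  rw [hc, mul_smul_comm, mul_one, smul_mul_assoc, proj_mul_proj] at hsum
  refine ⟨((Finset.univ.filter (· ∈ C.logicalPaulis)).card : ℂ)⁻¹ * c, ?_⟩
  rw [mul_smul, hsum, smul_smul, inv_mul_cancel₀ hcard, one_smul]

theorem star_mem_turns {V : QubitOp n} (hV : V ∈ C.turns) : Vᴴ ∈ C.turns := by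
  induction hV using Submonoid.closure_induction with
  | mem V h =>
    obtain ⟨K, hK, hK2, rfl⟩ := h
    have : (quarterTurn K)ᴴ = quarterTurn K⁻¹ := by
      rw [quarterTurn, Matrix.conjTranspose_smul, Matrix.conjTranspose_add,
        conjTranspose_toMatrix, quarterTurn]
      simp
    rw [this]
    refine quarterTurn_mem_turns (inv_mem hK) ?_
    rw [← mul_inv_rev, hK2, inv_eq_of_mul_eq_one_left negOne_mul_negOne]
  | one => simp
  | mul V W _ _ hV hW => rw [Matrix.conjTranspose_mul]; exact mul_mem hW hV

/-- Every Clifford operator on a stabilizer code acts on code states as a product of quarter turns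
about logical Pauli operators. -/
theorem IsClifford.exists_turns {W : QubitOp n} (hW : C.IsClifford W) :
    ∃ V ∈ C.turns, ∀ ρ, C.IsState ρ → W * ρ * Wᴴ = V * ρ * Vᴴ := by
  obtain ⟨V, hV, hVA, hle⟩ := hW.actsAsClifford.exists_turns
  obtain ⟨c, hc⟩ := eq_smul_proj hVA.preserves hle
  have hW' : W * C.proj = c • (Vᴴ * C.proj) := by
    rw [← mul_smul_comm, ← hc, ← mul_assoc, ← mul_assoc, star_turns_mul hV, one_mul]
  have hcc : c * star c = 1 := by
    have h1 : (V * W * C.proj)ᴴ * (V * W * C.proj) = C.proj := by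
      rw [Matrix.conjTranspose_mul, mul_assoc, ← mul_assoc (V * W)ᴴ, hVA.star_mul, one_mul,
        conjTranspose_proj, proj_mul_proj]
    rw [hc, Matrix.conjTranspose_smul, conjTranspose_proj, smul_mul_smul_comm, proj_mul_proj] at h1
    have h2 : (star c * c - 1) • C.proj = 0 := by rw [sub_smul, h1, one_smul, sub_self]
    rw [mul_comm]
    exact sub_eq_zero.mp ((smul_eq_zero.mp h2).resolve_right C.proj_ne_zero)
  refine ⟨Vᴴ, star_mem_turns hV, fun ρ hρ => ?_⟩
  have hρ' : ρ = C.proj * ρ * C.projᴴ := by rw [conjTranspose_proj, hρ.proj_mul, hρ.mul_proj]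
  calc W * ρ * Wᴴ = W * C.proj * ρ * (W * C.proj)ᴴ := by
        conv_lhs => rw [hρ']
        simp only [Matrix.conjTranspose_mul, mul_assoc]
    _ = (c * star c) • (Vᴴ * C.proj * ρ * (Vᴴ * C.proj)ᴴ) := by
        rw [hW', Matrix.conjTranspose_smul]
        simp only [smul_mul_assoc, mul_smul_comm, smul_smul]
        rw [mul_comm]
    _ = Vᴴ * (C.proj * ρ * C.projᴴ) * Vᴴᴴ := by
        rw [hcc, one_smul, Matrix.conjTranspose_mul Vᴴ]; simp only [mul_assoc]
    _ = _ := by rw [← hρ']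

end StabilizerCode

/-! ### Elementary code rewirings as quarter turns -/

namespace Pauli

variable {n : ℕ}

@[simp] theorem symp_negOne_left (P : Pauli n) : symp (negOne n) P = 0 := by simp [symp, negOne]

@[simp] theorem symp_one_left (P : Pauli n) : symp 1 P = 0 := by simp [symp]

theorem symp_closure {s t : Set (Pauli n)} (h : ∀ a ∈ s, ∀ b ∈ t, symp a b = 0) {P Q : Pauli n}
    (hP : P ∈ Subgroup.closure s) (hQ : Q ∈ Subgroup.closure t) : symp P Q = 0 := by
  have h1 : ∀ a ∈ s, symp a Q = 0 := fun a ha => by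
    induction hQ using Subgroup.closure_induction with
    | mem b hb => exact h a ha b hb
    | one => rw [symp_comm, symp_one_left]
    | mul b c _ _ hb hc => rw [symp_mul_right, hb, hc, add_zero]
    | inv b _ hb => rw [symp_inv_right, hb]
  induction hP using Subgroup.closure_induction with
  | mem b hb => exact h1 b hb
  | one => rw [symp_one_left]
  | mul b c _ _ hb hc => rw [symp_mul_left, hb, hc, add_zero]
  | inv b _ hb => rw [symp_inv_left, hb]

end Pauli

/-- A commuting involution `h` occurs in a product of generators at most once. -/
theorem Subgroup.mem_or_mul_mem_of_mem_closure_insert {G : Type*} [Group G] {s : Set G} {h : G}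
    (hh : h * h = 1) (hs : ∀ a ∈ s, Commute h a) {P : G}
    (hP : P ∈ Subgroup.closure (insert h s)) :
    P ∈ Subgroup.closure s ∨ h * P ∈ Subgroup.closure s := by
  have hc : ∀ Q ∈ Subgroup.closure (insert h s), h * Q = Q * h := fun Q hQ => by
    have : Subgroup.closure (insert h s) ≤ Subgroup.centralizer {h} := by
      rw [Subgroup.closure_le]
      rintro a (rfl | ha) <;> rw [SetLike.mem_coe, Subgroup.mem_centralizer_iff]
      · rintro _ rfl; rfl
      · rintro _ rfl; exact hs a ha
    exact Subgroup.mem_centralizer_iff.mp (this hQ) h rfl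
  induction hP using Subgroup.closure_induction with
  | mem a ha =>
    rcases ha with rfl | ha
    · right; rw [hh]; exact one_mem _
    · left; exact Subgroup.subset_closure ha
  | one => left; exact one_mem _
  | mul a b ha hb iha ihb =>
    rcases iha with iha | iha <;> rcases ihb with ihb | ihb
    · left; exact mul_mem iha ihb
    · right; rw [← mul_assoc, hc a ha, mul_assoc]; exact mul_mem iha ihb
    · right; rw [← mul_assoc]; exact mul_mem iha ihb
    · left
      have := mul_mem iha ihb
      rwa [hc a ha, mul_assoc, ← mul_assoc h h, hh, one_mul] at this
  | inv a ha iha =>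
    rcases iha with iha | iha
    · left; exact inv_mem iha
    · right
      have h1 : h * a⁻¹ = (h * a)⁻¹ := by
        rw [hc a ha, mul_inv_rev, inv_eq_of_mul_eq_one_left hh]
      rw [h1]; exact inv_mem iha

/-- A generating set that is minimal under inclusion is independent. -/
theorem Subgroup.exists_independent_generators {G : Type*} [Group G] [Finite G]
    (H : Subgroup G) : ∃ (m : ℕ) (gen : Fin m → G), Subgroup.closure (Set.range gen) = H ∧
      ∀ i, gen i ∉ Subgroup.closure (gen '' {j | j ≠ i}) := by
  classical
  have hne : {s : Finset G | Subgroup.closure (s : Set G) = H}.Nonempty :=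
    ⟨(Set.toFinite (H : Set G)).toFinset, by simp⟩
  obtain ⟨s, hs, hmin⟩ := exists_minimal_of_wellFoundedLT
    (fun s : Finset G => Subgroup.closure (s : Set G) = H) hne
  have hrange : Set.range (fun i => (s.equivFin.symm i : G)) = s := by
    ext a
    constructor
    · rintro ⟨i, rfl⟩; exact (s.equivFin.symm i).2
    · intro ha; exact ⟨s.equivFin ⟨a, ha⟩, by simp⟩
  refine ⟨s.card, fun i => s.equivFin.symm i, by rw [hrange, hs], fun i hi => ?_⟩
  have himg : (fun i => (s.equivFin.symm i : G)) '' {j | j ≠ i} ⊆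
      (s.erase (s.equivFin.symm i) : Finset G) := by
    rintro _ ⟨j, hj, rfl⟩
    rw [Finset.mem_coe, Finset.mem_erase]
    exact ⟨fun h => hj (s.equivFin.symm.injective (Subtype.ext h)), (s.equivFin.symm j).2⟩
  have hi' := Subgroup.closure_mono himg hi
  have hcl : Subgroup.closure ((s.erase (s.equivFin.symm i) : Finset G) : Set G) = H := by
    refine le_antisymm ?_ ?_
    · rw [← hs]; exact Subgroup.closure_mono (by simp)
    · rw [← hs, Subgroup.closure_le]
      intro a ha
      by_cases h : a = s.equivFin.symm i
      · rw [h]; exact hi'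
      · exact Subgroup.subset_closure (by simpa using ⟨ha, h⟩)
  have := hmin hcl (Finset.erase_subset _ _) (s.equivFin.symm i).2
  simp at this

section Rewirings

open Pauli

variable {n m k : ℕ}

/-- When `b` stabilizes the state and anticommutes with `a`, correcting the measurement of `a` by
`b` turns the outcome `-1` into the outcome `1`. -/
theorem measureCorrect_eq {a b : Pauli n} {σ : QubitOp n} (hb : b.IsObservable)
    (hab : symp a b = 1) (hl : b.toMatrix * σ = σ) (hr : σ * b.toMatrix = σ) :
    measureCorrect a b σ = (1 / 2 : ℂ) • ((1 + a.toMatrix) * σ * (1 + a.toMatrix)) := by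
  have h1 : b.toMatrix * (1 - a.toMatrix) = (1 + a.toMatrix) * b.toMatrix := by
    rw [add_mul, toMatrix_mul_anticomm hab]; noncomm_ring
  have h2 : (1 - a.toMatrix) * b.toMatrix = b.toMatrix * (1 + a.toMatrix) := by
    rw [sub_mul, toMatrix_mul_anticomm hab]; noncomm_ring
  have hb' : b.toMatrixᴴ = b.toMatrix := by
    rw [conjTranspose_toMatrix, inv_eq_of_mul_eq_one_left hb]
  have h3 : b.toMatrix * ((1 - a.toMatrix) * σ * (1 - a.toMatrix)) * b.toMatrix =
      (1 + a.toMatrix) * σ * (1 + a.toMatrix) := by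
    calc _ = b.toMatrix * (1 - a.toMatrix) * σ * ((1 - a.toMatrix) * b.toMatrix) := by
          simp only [mul_assoc]
      _ = (1 + a.toMatrix) * (b.toMatrix * σ * b.toMatrix) * (1 + a.toMatrix) := by
          rw [h1, h2]; simp only [mul_assoc]
      _ = _ := by rw [hl, hr]
  simp only [measureCorrect, hb', smul_mul_assoc, mul_smul_comm, smul_smul, h3, ← add_smul]
  norm_num

theorem mul_measured {a : Pauli n} (ha : a.IsObservable) (σ : QubitOp n) :
    a.toMatrix * ((1 / 2 : ℂ) • ((1 + a.toMatrix) * σ * (1 + a.toMatrix))) =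
      (1 / 2 : ℂ) • ((1 + a.toMatrix) * σ * (1 + a.toMatrix)) := by
  have h : a.toMatrix * (1 + a.toMatrix) = 1 + a.toMatrix := by
    rw [mul_add, ← toMatrix_mul, show a * a = 1 from ha, toMatrix_one, mul_one, add_comm]
  rw [mul_smul_comm, ← mul_assoc, ← mul_assoc, h]

theorem measured_mul {a : Pauli n} (ha : a.IsObservable) (σ : QubitOp n) :
    ((1 / 2 : ℂ) • ((1 + a.toMatrix) * σ * (1 + a.toMatrix))) * a.toMatrix =
      (1 / 2 : ℂ) • ((1 + a.toMatrix) * σ * (1 + a.toMatrix)) := by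
  have h : (1 + a.toMatrix) * a.toMatrix = 1 + a.toMatrix := by
    rw [add_mul, ← toMatrix_mul, show a * a = 1 from ha, toMatrix_one, one_mul, add_comm]
  rw [smul_mul_assoc, mul_assoc, h]

/-- On states stabilized by the rewired generator, an elementary code rewiring by a rewiring pair
`(g, g')` is the quarter turn about `g' g`. -/
theorem Rewiring.IsRewiringPair.process_eq {R : Rewiring n m} {gen : Fin m → Pauli n}
    {X Z : Fin k → Pauli n} (hR : R.IsRewiringPair gen X Z) (hG : (gen R.idx).IsObservable)
    {ρ : QubitOp n} (hl : (gen R.idx).toMatrix * ρ = ρ) (hr : ρ * (gen R.idx).toMatrix = ρ) :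
    R.process gen ρ = quarterTurn (R.g' * R.g) * ρ * (quarterTurn (R.g' * R.g))ᴴ := by
  obtain ⟨hg, hg', ⟨-, hgG⟩, -, ⟨-, hg'G⟩, hgg'⟩ := hR
  rw [antiCommute_iff] at hgG hg'G hgg'
  rw [process, measureCorrect_eq hG hgG hl hr,
    measureCorrect_eq hg (by rwa [symp_comm]) (mul_measured hg _) (measured_mul hg _),
    measureCorrect_eq hg' (by rwa [symp_comm]) (mul_measured hg' _) (measured_mul hg' _)]
  have h1 := toMatrix_mul_anticomm hgG
  have h2 := toMatrix_mul_anticomm hg'G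
  have e1 : R.g.toMatrixᴴ = R.g.toMatrix := by
    rw [conjTranspose_toMatrix, inv_eq_of_mul_eq_one_left hg]
  have e2 : R.g'.toMatrixᴴ = R.g'.toMatrix := by
    rw [conjTranspose_toMatrix, inv_eq_of_mul_eq_one_left hg']
  have e3 : star ((Real.sqrt 2 : ℂ)⁻¹) = (Real.sqrt 2 : ℂ)⁻¹ := by simp
  have hcoef := StabilizerCode.inv_sqrt_two_mul_self
  rw [quarterTurn, Matrix.conjTranspose_smul, e3, Matrix.conjTranspose_add,
    Matrix.conjTranspose_one, toMatrix_mul, Matrix.conjTranspose_mul, e1, e2]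
  generalize (Real.sqrt 2 : ℂ)⁻¹ = c at hcoef
  generalize (gen R.idx).toMatrix = G at *
  generalize R.g.toMatrix = a at *
  generalize R.g'.toMatrix = b at *
  have hL : (1 + G) * ((1 + b) * ((1 + a) * ρ)) = (2 : ℂ) • ((1 + b * a) * ρ) := by
    have : G * ((1 + b) * ((1 + a) * ρ)) = (1 - b) * ((1 - a) * ρ) := by
      have i1 : G * (1 + b) = (1 - b) * G := by rw [sub_mul, h2]; noncomm_ring
      have i2 : G * (1 + a) = (1 - a) * G := by rw [sub_mul, h1]; noncomm_ring
      rw [← mul_assoc, i1, mul_assoc, ← mul_assoc G, i2, mul_assoc, hl]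
    rw [add_mul, this, two_smul]; noncomm_ring
  have hRt : ∀ τ : QubitOp n, τ * G = τ → τ * (1 + a) * (1 + b) * (1 + G) =
      (2 : ℂ) • (τ * (1 + a * b)) := fun τ hτ => by
    have : τ * (1 + a) * (1 + b) * G = τ * (1 - a) * (1 - b) := by
      have i1 : (1 + b) * G = G * (1 - b) := by rw [add_mul, h2]; noncomm_ring
      have i2 : (1 + a) * G = G * (1 - a) := by rw [add_mul, h1]; noncomm_ring
      rw [mul_assoc, i1, ← mul_assoc, mul_assoc τ, i2, ← mul_assoc, hτ]
    rw [mul_add, this, two_smul]; noncomm_ring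
  simp only [smul_mul_assoc, mul_smul_comm, smul_smul]
  have h3 : (1 + G) * ((1 + b) * ((1 + a) * ρ * (1 + a)) * (1 + b)) * (1 + G) =
      (4 : ℂ) • ((1 + b * a) * ρ * (1 + a * b)) := by
    calc _ = (1 + G) * ((1 + b) * ((1 + a) * ρ)) * (1 + a) * (1 + b) * (1 + G) := by
          simp only [mul_assoc]
      _ = (2 : ℂ) • ((1 + b * a) * (ρ * (1 + a) * (1 + b) * (1 + G))) := by
          rw [hL]; simp only [smul_mul_assoc, mul_assoc]
      _ = _ := by
          rw [hRt ρ hr, mul_smul_comm, smul_smul, mul_assoc]; norm_num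
  rw [h3, smul_smul, hcoef]
  norm_num

/-- The code obtained from independent stabilizer generators by replacing one of them by an
observable that anticommutes with it and commutes with the others. Its distance is at least that
of any code whose stabilizers are generated by the remaining generators. -/
theorem exists_replaced_code {C D : StabilizerCode n} {gen : Fin m → Pauli n}
    (hgen : C.IsGenerators gen) (R : Rewiring n m)
    (hD : D.stab ≤ Subgroup.closure (gen '' {j | j ≠ R.idx})) {h : Pauli n} (hh : h.IsObservable)
    (hc : ∀ j, j ≠ R.idx → Commute h (gen j)) (hac : h.AntiCommute (gen R.idx)) :
    ∃ C₁ : StabilizerCode n, C₁.stab = R.replacedStab gen h ∧ D.distance ≤ C₁.distance := by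
  have hrange : Set.range (Function.update gen R.idx h) = insert h (gen '' {j | j ≠ R.idx}) := by
    ext P
    constructor
    · rintro ⟨j, rfl⟩
      by_cases hj : j = R.idx
      · subst hj; simp
      · right; exact ⟨j, hj, by simp [hj]⟩
    · rintro (rfl | ⟨j, hj, rfl⟩)
      · exact ⟨R.idx, by simp⟩
      · exact ⟨j, by simp [show j ≠ R.idx from hj]⟩
  have hle : Subgroup.closure (gen '' {j | j ≠ R.idx}) ≤ C.stab := by
    rw [← hgen.1]; exact Subgroup.closure_mono (Set.image_subset_range _ _)
  have hs : ∀ a ∈ gen '' {j | j ≠ R.idx}, Commute h a := by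
    rintro _ ⟨j, hj, rfl⟩; exact hc j hj
  have hmem : ∀ i, gen i ∈ C.stab := fun i => hgen.1 ▸ Subgroup.subset_closure ⟨i, rfl⟩
  refine ⟨⟨R.replacedStab gen h, fun P hP Q hQ => ?_, fun hneg => ?_⟩, rfl,
    StabilizerCode.distance_mono ?_⟩
  · rw [Rewiring.replacedStab, hrange] at hP hQ
    refine commute_iff.mpr (symp_closure ?_ hP hQ)
    rintro a (rfl | ha) b (rfl | hb)
    · exact symp_self _
    · exact commute_iff.mp (hs b hb)
    · exact commute_iff.mp (hs a ha).symm
    · exact C.symp_stab (hle (Subgroup.subset_closure ha)) (hle (Subgroup.subset_closure hb))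
  · rw [Rewiring.replacedStab, hrange] at hneg
    rcases Subgroup.mem_or_mul_mem_of_mem_closure_insert hh hs hneg with h1 | h1
    · exact C.negOne_notMem (hle h1)
    · have h2 := C.symp_stab (hle h1) (hmem R.idx)
      rw [symp_mul_left, antiCommute_iff.mp hac, symp_negOne_left] at h2
      exact absurd h2 (by decide)
  · refine hD.trans ?_
    change _ ≤ R.replacedStab gen h
    rw [Rewiring.replacedStab, hrange]
    exact Subgroup.closure_mono (Set.subset_insert _ _)

theorem Rewiring.IsRewiringPair.intermediateDistanceGE {R : Rewiring n m} {gen : Fin m → Pauli n}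
    {X Z : Fin k → Pauli n} (hR : R.IsRewiringPair gen X Z) {C D : StabilizerCode n}
    (hgen : C.IsGenerators gen)
    (hD : D.stab ≤ Subgroup.closure (gen '' {j | j ≠ R.idx})) :
    R.IntermediateDistanceGE gen D.distance :=
  ⟨exists_replaced_code hgen R hD hR.1 hR.2.2.1.1 hR.2.2.1.2,
    exists_replaced_code hgen R hD hR.2.1 hR.2.2.2.2.1.1 hR.2.2.2.2.1.2⟩

/-- There is a Pauli observable that anticommutes with a given generator, and commutes with the
other generators and with the logical operators. -/
theorem exists_rewiring_operator {C : StabilizerCode n} {gen : Fin m → Pauli n}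
    (hgen : C.IsGenerators gen) (l : Fin m) {X Z : Fin k → Pauli n}
    (hXZ : C.IsLogicalFamily X Z) :
    ∃ g : Pauli n, g.IsObservable ∧ (∀ j, j ≠ l → symp g (gen j) = 0) ∧ symp g (gen l) = 1 ∧
      ∀ j, symp g (X j) = 0 ∧ symp g (Z j) = 0 := by
  have hmem : ∀ i, gen i ∈ C.stab := fun i => hgen.1 ▸ Subgroup.subset_closure ⟨i, rfl⟩
  let H := Subgroup.closure (gen '' {j | j ≠ l})
  have hle : H ≤ C.stab := by
    rw [← hgen.1]; exact Subgroup.closure_mono (Set.image_subset_range _ _)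
  let F : Subgroup (Pauli n) :=
    { carrier := {P | ∃ a ∈ H, a.x = P.x ∧ a.z = P.z}
      mul_mem' := by
        rintro P Q ⟨a, ha, hx, hz⟩ ⟨b, hb, hx', hz'⟩
        exact ⟨a * b, mul_mem ha hb, by simp [hx, hx'], by simp [hz, hz']⟩
      one_mem' := ⟨1, one_mem _, rfl, rfl⟩
      inv_mem' := fun ⟨a, ha, hx, hz⟩ => ⟨a, ha, hx, hz⟩ }
  have hl : gen l ∉ F := by
    rintro ⟨a, ha, hx, hz⟩
    have h1 : a * gen l = 1 := by
      refine C.eq_one_of_mem_stab (mul_mem (hle ha) (hmem l)) ?_ ?_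
      · rw [mul_x, hx]; exact funext fun _ => CharTwo.add_self_eq_zero _
      · rw [mul_z, hz]; exact funext fun _ => CharTwo.add_self_eq_zero _
    exact hgen.2 l (by rw [eq_inv_of_mul_eq_one_right h1]; exact inv_mem ha)
  obtain ⟨t, htF, htl⟩ := exists_antiCommute_of_notMem (F := F) ⟨1, one_mem _, rfl, rfl⟩ hl
  -- the logical part of `t` is removed
  obtain ⟨g, hg, hgx, hgz⟩ := exists_observable (n := n)
    ⟨0, t.x + ∑ i, (symp t (Z i) • (X i).x + symp t (X i) • (Z i).x),
      t.z + ∑ i, (symp t (Z i) • (X i).z + symp t (X i) • (Z i).z)⟩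
  have hgQ : ∀ Q : Pauli n, symp g Q = symp t Q +
      ∑ i, (symp t (Z i) * symp (X i) Q + symp t (X i) * symp (Z i) Q) := by
    intro Q
    rw [symp, hgx, hgz]
    simp only [symp, add_dotProduct, dotProduct_add, sum_dotProduct, dotProduct_sum,
      smul_dotProduct, dotProduct_smul, smul_eq_mul, mul_add, Finset.sum_add_distrib]
    ring
  have hstab : ∀ Q ∈ C.stab, symp g Q = symp t Q := fun Q hQ => by
    rw [hgQ, Finset.sum_eq_zero, add_zero]
    intro i _
    rw [symp_comm (X i), symp_comm (Z i), C.mem_logicalPaulis_iff.mp (hXZ.1 i).1 Q hQ,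
      C.mem_logicalPaulis_iff.mp (hXZ.2.1 i).1 Q hQ]
    simp
  obtain ⟨-, -, hXX, hZZ, hac, hcomm⟩ := hXZ
  have hXZ' : ∀ i j, symp (X i) (Z j) = if i = j then 1 else 0 := fun i j => by
    split_ifs with h
    · subst h; exact antiCommute_iff.mp (hac i)
    · exact commute_iff.mp (hcomm i j h)
  refine ⟨g, hg, fun j hj => ?_, by rw [hstab _ (hmem l), htl], fun j => ⟨?_, ?_⟩⟩
  · rw [hstab _ (hmem j)]
    exact htF _ ⟨gen j, Subgroup.subset_closure ⟨j, hj, rfl⟩, rfl, rfl⟩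
  · rw [hgQ]
    simp only [fun i => commute_iff.mp (hXX i j), fun i => symp_comm (Z i) (X j), hXZ']
    simp [CharTwo.add_self_eq_zero]
  · rw [hgQ]
    simp only [fun i => commute_iff.mp (hZZ i j), hXZ']
    simp [CharTwo.add_self_eq_zero]

/-- Every logical quarter turn is induced by an elementary code rewiring of any given generator.
Since the generator acts trivially on the code, the axis `K` may be multiplied by it in order to
anticommute with `g`, and then `g' = K g` completes a rewiring pair. -/
theorem exists_rewiringPair {C : StabilizerCode n} {gen : Fin m → Pauli n}
    (hgen : C.IsGenerators gen) (l : Fin m) {X Z : Fin k → Pauli n}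
    (hXZ : C.IsLogicalFamily X Z) {K : Pauli n} (hK : K ∈ C.logicalPaulis)
    (hK2 : K * K = negOne n) :
    ∃ R : Rewiring n m, R.idx = l ∧ R.IsRewiringPair gen X Z ∧
      ∀ ρ, C.proj * ρ = ρ → ρ * C.proj = ρ →
        R.process gen ρ = quarterTurn K * ρ * (quarterTurn K)ᴴ := by
  have hmem : ∀ i, gen i ∈ C.stab := fun i => hgen.1 ▸ Subgroup.subset_closure ⟨i, rfl⟩
  have hG : gen l * gen l = 1 := C.mul_self_of_mem_stab (hmem l)
  obtain ⟨g, hg, hgj, hgl, hgXZ⟩ := exists_rewiring_operator hgen l hXZ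
  have hgg : g * g = 1 := hg
  obtain ⟨K', hK', hK'2, hK'g, hKK'⟩ : ∃ K' ∈ C.logicalPaulis, K' * K' = negOne n ∧
      symp g K' = 1 ∧ K'.toMatrix * C.proj = K.toMatrix * C.proj := by
    rcases symp_eq_zero_or_one g K with e | e
    · refine ⟨K * gen l, mul_mem hK (C.stab_le_logicalPaulis (hmem l)), ?_, ?_, ?_⟩
      · have hc : K * gen l = gen l * K :=
          (commute_iff.mpr (C.mem_logicalPaulis_iff.mp hK _ (hmem l))).symm
        calc K * gen l * (K * gen l) = K * (gen l * K) * gen l := by group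
          _ = (K * K) * (gen l * gen l) := by rw [← hc]; group
          _ = _ := by rw [hK2, hG, mul_one]
      · rw [symp_mul_right, e, hgl, zero_add]
      · rw [toMatrix_mul, mul_assoc, C.mul_proj (hmem l)]
    · exact ⟨K, hK, hK2, e, rfl⟩
  have hK's : ∀ j, symp K' (gen j) = 0 := fun j => by
    rw [symp_comm]; exact C.mem_logicalPaulis_iff.mp hK' _ (hmem j)
  have hpair : (⟨l, g, K' * g⟩ : Rewiring n m).IsRewiringPair gen X Z := by
    refine ⟨hg, ?_, ⟨fun j hj => commute_iff.mpr (hgj j hj), antiCommute_iff.mpr hgl⟩,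
      fun j => ⟨commute_iff.mpr (hgXZ j).1, commute_iff.mpr (hgXZ j).2⟩,
      ⟨fun j hj => commute_iff.mpr ?_, antiCommute_iff.mpr ?_⟩, antiCommute_iff.mpr ?_⟩
    · have hac : g * K' = negOne n * (K' * g) := antiCommute_iff.mpr hK'g
      change K' * g * (K' * g) = 1
      calc K' * g * (K' * g) = K' * (g * K') * g := by group
        _ = negOne n * (K' * K') * (g * g) := by
          rw [hac, ← mul_assoc K', ← (commute_negOne K').eq]; group
        _ = 1 := by rw [hK'2, hgg, negOne_mul_negOne, mul_one]
    · rw [symp_mul_left, hK's, hgj j hj, add_zero]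
    · rw [symp_mul_left, hK's, hgl, zero_add]
    · rw [symp_mul_right, hK'g, symp_self, add_zero]
  refine ⟨⟨l, g, K' * g⟩, rfl, hpair, fun ρ hl hr => ?_⟩
  have h1 : (gen l).toMatrix * ρ = ρ := by rw [← hl, ← mul_assoc, C.mul_proj (hmem l)]
  have h2 : ρ * (gen l).toMatrix = ρ := by rw [← hr, mul_assoc, C.proj_mul (hmem l)]
  rw [hpair.process_eq hG h1 h2]
  have h3 : K' * g * g = K' := by rw [mul_assoc, hgg, mul_one]
  have h4 : quarterTurn K' * C.proj = quarterTurn K * C.proj := by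
    rw [quarterTurn, quarterTurn, smul_mul_assoc, smul_mul_assoc, add_mul, add_mul, hKK']
  have key : ∀ A : QubitOp n, A * ρ * Aᴴ = A * C.proj * ρ * (A * C.proj)ᴴ := fun A => by
    have hρ : ρ = C.proj * ρ * C.proj := by rw [hl, hr]
    conv_lhs => rw [hρ]
    simp only [Matrix.conjTranspose_mul, C.conjTranspose_proj, mul_assoc]
  rw [h3, key, h4, ← key]

/-- Products of logical quarter turns are induced by sequences of elementary code rewirings of any
given generator. -/
theorem exists_rewirings {C : StabilizerCode n} {gen : Fin m → Pauli n}
    (hgen : C.IsGenerators gen) (l : Fin m) {X Z : Fin k → Pauli n}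
    (hXZ : C.IsLogicalFamily X Z) {V : QubitOp n} (hV : V ∈ C.turns) :
    ∃ L : List (Rewiring n m), (∀ R ∈ L, R.idx = l ∧ R.IsRewiringPair gen X Z) ∧
      ∀ ρ, C.proj * ρ = ρ → ρ * C.proj = ρ → Rewiring.processList L gen ρ = V * ρ * Vᴴ := by
  induction hV using Submonoid.closure_induction with
  | mem V h =>
    obtain ⟨K, hK, hK2, rfl⟩ := h
    obtain ⟨R, h1, h2, h3⟩ := exists_rewiringPair hgen l hXZ hK hK2
    exact ⟨[R], by simp [h1, h2], h3⟩
  | one => exact ⟨[], by simp, by simp [Rewiring.processList]⟩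
  | mul V W hVm hWm hV hW =>
    obtain ⟨L, hL, hL'⟩ := hV
    obtain ⟨M, hM, hM'⟩ := hW
    refine ⟨M ++ L, fun R hR => ?_, fun ρ h1 h2 => ?_⟩
    · rcases List.mem_append.mp hR with h | h
      exacts [hM R h, hL R h]
    · have e1 := StabilizerCode.turns_proj hWm
      have e2 : C.proj * Wᴴ = Wᴴ * C.proj := by
        have := congrArg Matrix.conjTranspose e1
        simpa only [Matrix.conjTranspose_mul, C.conjTranspose_proj] using this
      rw [Rewiring.processList, List.foldl_append]
      change Rewiring.processList L gen (Rewiring.processList M gen ρ) = _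
      rw [hM' ρ h1 h2, hL', Matrix.conjTranspose_mul]
      · simp only [mul_assoc]
      · rw [← mul_assoc, ← mul_assoc, ← e1, mul_assoc W, h1]
      · rw [mul_assoc, ← e2, ← mul_assoc, mul_assoc W, h2]

end Rewirings

/-! ### Codes obtained by gauge fixing -/

/-- Independent generators of a code, in which a stabilizer outside the subgroup `H` is the only
generator that does not lie in `H`. -/
theorem exists_generators_cons {n : ℕ} (C : StabilizerCode n) {H : Subgroup (Pauli n)}
    {f : Pauli n} (hf : f ∉ H) (hC : C.stab = H ⊔ Subgroup.closure {f}) :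
    ∃ (m : ℕ) (gen : Fin (m + 1) → Pauli n), C.IsGenerators gen ∧
      Subgroup.closure (gen '' {j | j ≠ 0}) = H := by
  obtain ⟨m, gen, hgen, hind⟩ := H.exists_independent_generators
  have himg0 : Fin.cons f gen '' {j | j ≠ 0} = Set.range gen := by
    ext P
    constructor
    · rintro ⟨j, hj, rfl⟩
      obtain ⟨i, rfl⟩ := Fin.exists_succ_eq.mpr hj
      exact ⟨i, by simp⟩
    · rintro ⟨i, rfl⟩; exact ⟨i.succ, Fin.succ_ne_zero i, by simp⟩
  have hHC : H ≤ C.stab := hC ▸ le_sup_left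
  have hfC : f ∈ C.stab := hC ▸ (le_sup_right : _ ≤ H ⊔ _) (Subgroup.subset_closure rfl)
  have hgm : ∀ i, gen i ∈ H := fun i => hgen ▸ Subgroup.subset_closure ⟨i, rfl⟩
  refine ⟨m, Fin.cons f gen, ⟨?_, ?_⟩, by rw [himg0, hgen]⟩
  · rw [Fin.range_cons, Set.insert_eq, Set.union_comm, Subgroup.closure_union, hgen, hC]
  · refine Fin.cases ?_ fun i => ?_
    · rwa [himg0, hgen]
    · have himg : Fin.cons f gen '' {j | j ≠ i.succ} ⊆ insert f (gen '' {j | j ≠ i}) := by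
        rintro _ ⟨j, hj, rfl⟩
        refine Fin.cases (fun _ => by simp) (fun i' hj => ?_) j hj
        right; exact ⟨i', fun h => hj (by rw [h]), by simp⟩
      intro hi
      rw [Fin.cons_succ] at hi
      have hle : Subgroup.closure (gen '' {j | j ≠ i}) ≤ H := by
        rw [← hgen]; exact Subgroup.closure_mono (Set.image_subset_range _ _)
      rcases Subgroup.mem_or_mul_mem_of_mem_closure_insert (C.mul_self_of_mem_stab hfC)
        (by rintro _ ⟨j, -, rfl⟩; exact C.comm _ hfC _ (hHC (hgm j)))
        (Subgroup.closure_mono himg hi) with h | h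
      · exact hind i h
      · exact hf (by simpa using mul_mem (hle h) (inv_mem (hgm i)))

/-- The stabilizers of the subsystem code and all but one of the fixed gauge operators generate a
subgroup, generators of which are completed by the remaining gauge operator. As only that generator
is ever rewired, the intermediate codes inherit the distance of the subsystem code. -/
theorem gaugeFixing_rewiring {n r s : ℕ} {Chat : SubsystemCode n r} {C : StabilizerCode n}
    (hs : 1 ≤ s) (hfix : Chat.IsGaugeFixing C s) :
    Chat.code.distance ≤ C.distance ∧
      ∃ (m : ℕ) (gen : Fin m → Pauli n), C.IsGenerators gen ∧
        ∀ (k : ℕ) (X Z : Fin k → Pauli n), C.IsLogicalBasis X Z →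
          ∀ W : QubitOp n, C.IsClifford W →
            ∃ l : List (Rewiring n m),
              (∀ R ∈ l, R.IsRewiringPair gen X Z ∧
                R.IntermediateDistanceGE gen Chat.code.distance) ∧
              C.Induces (Rewiring.processList l gen) W := by
  obtain ⟨f, -, hC, hf⟩ := hfix
  have hle : Chat.code.stab ≤ C.stab := hC ▸ le_sup_left
  refine ⟨StabilizerCode.distance_mono hle, ?_⟩
  let i₀ : Fin s := ⟨0, hs⟩
  have hC' : C.stab = (Chat.code.stab ⊔ Subgroup.closure (f '' {j | j ≠ i₀})) ⊔
      Subgroup.closure {f i₀} := by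
    rw [hC, sup_assoc, ← Subgroup.closure_union]
    congr 2
    ext P
    constructor
    · rintro ⟨j, rfl⟩
      by_cases h : j = i₀
      · right; rw [h]; rfl
      · left; exact ⟨j, h, rfl⟩
    · rintro (⟨j, -, rfl⟩ | rfl) <;> exact ⟨_, rfl⟩
  obtain ⟨m, gen, hgen, hH⟩ := exists_generators_cons C (hf i₀) hC'
  refine ⟨m + 1, gen, hgen, fun k X Z hXZ W hW => ?_⟩
  obtain ⟨V, hV, hVW⟩ := hW.exists_turns
  obtain ⟨L, hL, hL'⟩ := exists_rewirings hgen 0 hXZ.2 hV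
  refine ⟨L, fun R hR => ⟨(hL R hR).2, (hL R hR).2.intermediateDistanceGE hgen ?_⟩,
    fun ρ hρ => ?_⟩
  · rw [(hL R hR).1, hH]; exact le_sup_left
  · rw [hL' ρ hρ.proj_mul hρ.mul_proj, hVW ρ hρ]

/-! ### The 15-qubit Hamming and Reed–Muller codes -/

section HammingCodes

open Pauli

/-- The pairs `i < j` of rows of the parity check matrix. The pair at position `Fin.rev k` is the
complement of the pair at position `k`. -/
def rowPair : Fin 6 → Fin 4 × Fin 4 := ![(0, 1), (0, 2), (0, 3), (1, 2), (1, 3), (2, 3)]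

/-- The product of a pair of rows of the parity check matrix. -/
def hammingProduct (k : Fin 6) : Fin 15 → ZMod 2 :=
  hammingRow (rowPair k).1 * hammingRow (rowPair k).2

/-- The generators `X_{h_i}`, `Z_{h_i}` of the quantum Hamming code. -/
def hammingGen : Fin 8 → Pauli 15 :=
  Fin.append (m := 4) (n := 4) (fun i => ofX (hammingRow i)) fun i => ofZ (hammingRow i)

/-- The generators of the Reed–Muller code: those of the quantum Hamming code, and then the
operators `Z_{h_i h_j}`. -/
def reedMullerGen : Fin 14 → Pauli 15 :=
  Fin.append (m := 8) (n := 6) hammingGen fun k => ofZ (hammingProduct k)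

/-- The unit vector at the column `2 ^ i` of the parity check matrix, which has its only nonzero
entry in the row `i`. -/
def unitColumn (i : Fin 4) (j : Fin 15) : ZMod 2 := if j.val + 1 = 2 ^ i.val then 1 else 0

/-- Operators which anticommute with one generator of the Reed–Muller code each, and commute with
the others. -/
def reedMullerDual : Fin 14 → Pauli 15 :=
  Fin.append (m := 8) (n := 6)
    (Fin.append (m := 4) (n := 4) (fun i => ofZ (unitColumn i)) fun i => ofX (unitColumn i))
    fun k => ofX (hammingProduct k.rev)

theorem symp_reedMullerDual : ∀ i j : Fin 14,
    symp (reedMullerDual i) (reedMullerGen j) = if i = j then 1 else 0 := by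
  decide +kernel

theorem symp_reedMullerGen : ∀ i j : Fin 14, symp (reedMullerGen i) (reedMullerGen j) = 0 := by
  decide +kernel

/-- Generators are independent if there are dual operators, each of which anticommutes with just one
generator. -/
theorem StabilizerCode.isGenerators_of_dual {n m : ℕ} {C : StabilizerCode n}
    {gen dual : Fin m → Pauli n} (hgen : Subgroup.closure (Set.range gen) = C.stab)
    (hdual : ∀ i j, symp (dual i) (gen j) = if i = j then 1 else 0) : C.IsGenerators gen := by
  refine ⟨hgen, fun i hi => ?_⟩
  have h := symp_closure (s := {dual i}) (t := gen '' {j | j ≠ i}) (by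
    rintro _ rfl _ ⟨j, hj, rfl⟩
    rw [hdual, if_neg fun h => hj h.symm]) (Subgroup.subset_closure rfl) hi
  rw [hdual, if_pos rfl] at h
  exact absurd h (by decide)

theorem Fin.range_append {α : Type*} {a b : ℕ} (f : Fin a → α) (g : Fin b → α) :
    Set.range (Fin.append f g) = Set.range f ∪ Set.range g := by
  ext y
  constructor
  · rintro ⟨i, rfl⟩
    refine Fin.addCases (fun i => ?_) (fun i => ?_) i <;> simp
  · rintro (⟨i, rfl⟩ | ⟨i, rfl⟩)
    exacts [⟨Fin.castAdd b i, by simp⟩, ⟨Fin.natAdd a i, by simp⟩]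

theorem closure_hammingGen : Subgroup.closure (Set.range hammingGen) = hammingStab := by
  rw [hammingGen, Fin.range_append]; rfl

theorem closure_reedMullerGen :
    Subgroup.closure (Set.range reedMullerGen) = reedMullerStab := by
  rw [reedMullerGen, Fin.range_append, hammingGen, Fin.range_append, reedMullerStab]
  congr 2
  ext P
  constructor
  · rintro ⟨k, rfl⟩
    have : ∀ k, (rowPair k).1 < (rowPair k).2 := by decide
    exact ⟨_, _, this k, rfl⟩
  · rintro ⟨i, j, hij, rfl⟩
    have : ∀ i j : Fin 4, i < j → ∃ k, rowPair k = (i, j) := by decide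
    obtain ⟨k, hk⟩ := this i j hij
    exact ⟨k, by simp only [hammingProduct, hk]⟩

theorem reedMullerStab_eq_sup : reedMullerStab =
    hammingStab ⊔ Subgroup.closure (Set.range fun k => ofZ (hammingProduct k)) := by
  rw [← closure_reedMullerGen, ← closure_hammingGen, ← Subgroup.closure_union, reedMullerGen,
    Fin.range_append]

/-- The Reed–Muller stabilizers are the operators `X_a Z_b` without a phase, for certain `a` and `b`
orthogonal to each other. -/
theorem phase_of_mem_reedMullerStab {P : Pauli 15} (hP : P ∈ reedMullerStab) :
    P.phase = 0 ∧ P.x ∈ Submodule.span (ZMod 2) (Set.range hammingRow) ∧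
      ∀ v ∈ Submodule.span (ZMod 2) (Set.range hammingRow), P.z ⬝ᵥ v = 0 := by
  rw [← closure_reedMullerGen] at hP
  have hz : ∀ j i, (reedMullerGen j).z ⬝ᵥ hammingRow i = 0 := by decide +kernel
  have hx : ∀ j, (reedMullerGen j).x = 0 ∨ ∃ i, (reedMullerGen j).x = hammingRow i := by
    decide +kernel
  have hp : ∀ j, (reedMullerGen j).phase = 0 := by decide +kernel
  induction hP using Subgroup.closure_induction with
  | mem P h =>
    obtain ⟨j, rfl⟩ := h
    refine ⟨hp j, ?_, fun v hv => ?_⟩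
    · rcases hx j with h | ⟨i, h⟩ <;> rw [h]
      · exact zero_mem _
      · exact Submodule.subset_span ⟨i, rfl⟩
    · induction hv using Submodule.span_induction with
      | mem v h => obtain ⟨i, rfl⟩ := h; exact hz j i
      | zero => exact dotProduct_zero _
      | add v w _ _ h1 h2 => rw [dotProduct_add, h1, h2, add_zero]
      | smul c v _ h => rw [dotProduct_smul, h, smul_zero]
  | one => exact ⟨rfl, zero_mem _, fun v _ => zero_dotProduct _⟩
  | mul P Q _ _ hP hQ =>
    refine ⟨?_, add_mem hP.2.1 hQ.2.1, fun v hv => ?_⟩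
    · rw [mul_phase, hP.1, hQ.1, hP.2.2 _ hQ.2.1]; rfl
    · rw [mul_z, add_dotProduct, hP.2.2 v hv, hQ.2.2 v hv, add_zero]
  | inv P _ hP =>
    refine ⟨?_, hP.2.1, hP.2.2⟩
    rw [inv_def]
    change -P.phase + signPhase (P.z ⬝ᵥ P.x) = 0
    rw [hP.1, hP.2.2 _ hP.2.1]; rfl

/-- The 15-qubit Reed–Muller code. -/
def reedMullerCode : StabilizerCode 15 where
  stab := reedMullerStab
  comm P hP Q hQ := by
    rw [← closure_reedMullerGen] at hP hQ
    refine commute_iff.mpr (symp_closure ?_ hP hQ)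
    rintro _ ⟨i, rfl⟩ _ ⟨j, rfl⟩
    exact symp_reedMullerGen i j
  negOne_notMem h := absurd (phase_of_mem_reedMullerStab h).1 (by decide)

theorem hammingStab_le : hammingStab ≤ reedMullerStab := by
  rw [reedMullerStab_eq_sup]; exact le_sup_left

/-- The `[[15, 7, 3]]` quantum Hamming code. -/
def hammingCode : StabilizerCode 15 where
  stab := hammingStab
  comm P hP Q hQ := reedMullerCode.comm P (hammingStab_le hP) Q (hammingStab_le hQ)
  negOne_notMem h := reedMullerCode.negOne_notMem (hammingStab_le h)

theorem hammingCode_isGenerators : hammingCode.IsGenerators hammingGen := by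
  refine StabilizerCode.isGenerators_of_dual (dual := fun i => reedMullerDual (Fin.castAdd 6 i))
    closure_hammingGen fun i j => ?_
  have := symp_reedMullerDual (Fin.castAdd 6 i) (Fin.castAdd 6 j)
  simpa [reedMullerGen, Fin.ext_iff] using this

theorem reedMullerCode_isGenerators : reedMullerCode.IsGenerators reedMullerGen :=
  StabilizerCode.isGenerators_of_dual closure_reedMullerGen symp_reedMullerDual

theorem mem_logicalPaulis_of_symp {n m : ℕ} {C : StabilizerCode n} {gen : Fin m → Pauli n}
    (hgen : C.IsGenerators gen) {P : Pauli n} (h : ∀ j, symp (gen j) P = 0) :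
    P ∈ C.logicalPaulis := by
  refine C.mem_logicalPaulis_iff.mpr fun Q hQ => ?_
  rw [← hgen.1] at hQ
  refine symp_closure (t := {P}) ?_ hQ (Subgroup.subset_closure rfl)
  rintro _ ⟨j, rfl⟩ _ rfl
  exact h j

/-- The Hamming code has minimum distance at least `3`, as the columns of the parity check matrix
are nonzero and distinct. -/
theorem eq_zero_of_hammingRow {v : Fin 15 → ZMod 2} (hv : ∀ i, v ⬝ᵥ hammingRow i = 0)
    (hw : (Finset.univ.filter fun j => v j ≠ 0).card ≤ 2) : v = 0 := by
  have key : ∀ j k : Fin 15, j ≠ k → ∀ a b : ZMod 2,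
      (∀ i, a * hammingRow i j + b * hammingRow i k = 0) → a = 0 ∧ b = 0 := by
    decide +kernel
  have hsub : ∃ j k : Fin 15, j ≠ k ∧ ∀ i, i ≠ j → i ≠ k → v i = 0 := by
    obtain ⟨t, ht, hcard⟩ := Finset.exists_superset_card_eq hw (by simp)
    obtain ⟨j, k, hjk, rfl⟩ := Finset.card_eq_two.mp hcard
    refine ⟨j, k, hjk, fun i hij hik => ?_⟩
    by_contra h
    have := ht (Finset.mem_filter.mpr ⟨Finset.mem_univ i, h⟩)
    simp [hij, hik] at this
  obtain ⟨j, k, hjk, h0⟩ := hsub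
  have hjk0 := key j k hjk (v j) (v k) fun i => by
    rw [← hv i, dotProduct, Finset.sum_eq_add j k hjk _ (by simp) (by simp)]
    intro c _ hc
    rw [h0 c hc.1 hc.2, zero_mul]
  funext i
  by_cases hij : i = j
  · rw [hij]; exact hjk0.1
  · by_cases hik : i = k
    · rw [hik]; exact hjk0.2
    · exact h0 i hij hik

theorem three_le_hammingCode_distance : 3 ≤ hammingCode.distance := by
  refine le_iInf₂ fun P hP => ?_
  by_contra! hlt
  have hw : P.weight ≤ 2 := by
    have : P.weight < 3 := by exact_mod_cast hlt
    omega
  have hmem : ∀ j, symp P (hammingGen j) = 0 := fun j => by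
    rw [symp_comm]
    exact hammingCode.mem_logicalPaulis_iff.mp hP.1 _
      (hammingCode_isGenerators.1 ▸ Subgroup.subset_closure ⟨j, rfl⟩)
  have hx : P.x = 0 := by
    refine eq_zero_of_hammingRow (fun i => ?_) (le_trans (Finset.card_le_card ?_) hw)
    · have := hmem (Fin.natAdd 4 i)
      rwa [hammingGen, Fin.append_right, symp_ofZ_right, dotProduct_comm] at this
    · exact Finset.monotone_filter_right _ fun j _ h => Or.inl h
  have hz : P.z = 0 := by
    refine eq_zero_of_hammingRow (fun i => ?_) (le_trans (Finset.card_le_card ?_) hw)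
    · have := hmem (Fin.castAdd 4 i)
      rwa [hammingGen, Fin.append_left, symp_ofX_right] at this
    · exact Finset.monotone_filter_right _ fun j _ h => Or.inr h
  exact hP.2 ⟨1, one_mem _, hx.symm, hz.symm⟩

theorem hammingCode_distance : hammingCode.distance = 3 := by
  refine le_antisymm ?_ three_le_hammingCode_distance
  -- the bit flip on the columns `1`, `2`, `3`, whose sum vanishes
  let P : Pauli 15 := ofX fun j => if j.val < 3 then 1 else 0
  have hP : P ∈ hammingCode.logicalPaulis :=
    mem_logicalPaulis_of_symp hammingCode_isGenerators (by decide +kernel)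
  have hw : P.weight = 3 := by decide +kernel
  have h1 : ∀ j, symp (ofZ 1) (hammingGen j) = 0 := by decide +kernel
  have h2 : symp (ofZ 1) P = 1 := by decide +kernel
  refine (iInf₂_le P ⟨hP, ?_⟩).trans (by rw [hw]; rfl)
  rintro ⟨Q, hQ, hx, hz⟩
  -- a stabilizer flips an even number of bits
  have h3 : symp (ofZ 1) Q = 0 := by
    refine symp_closure (s := {ofZ 1}) ?_ (Subgroup.subset_closure rfl)
      (closure_hammingGen.symm ▸ hQ : Q ∈ Subgroup.closure (Set.range hammingGen))
    rintro _ rfl _ ⟨j, rfl⟩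
    exact h1 j
  rw [symp_comm, symp_congr_left hx hz, symp_comm, h2] at h3
  exact absurd h3 (by decide)

theorem symp_hammingProduct (i j : Fin 6) :
    symp (ofX (hammingProduct i.rev)) (ofZ (hammingProduct j)) = if i = j then 1 else 0 := by
  have := symp_reedMullerDual (Fin.natAdd 8 i) (Fin.natAdd 8 j)
  simpa [reedMullerGen, reedMullerDual, Fin.ext_iff] using this

theorem symp_hammingGen_hammingProduct : ∀ (j : Fin 8) (k : Fin 6),
    symp (hammingGen j) (ofX (hammingProduct k)) = 0 ∧
      symp (hammingGen j) (ofZ (hammingProduct k)) = 0 := by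
  decide +kernel

theorem isObservable_ofX {n : ℕ} (v : Fin n → ZMod 2) : (ofX v).IsObservable := by
  rw [IsObservable, mul_self]; simp [ofX, signPhase, one_def]

theorem isObservable_ofZ {n : ℕ} (v : Fin n → ZMod 2) : (ofZ v).IsObservable := by
  rw [IsObservable, mul_self]; simp [ofZ, signPhase, one_def]

theorem commute_ofX_ofX {n : ℕ} (v w : Fin n → ZMod 2) : Commute (ofX v) (ofX w) :=
  commute_iff.mpr (by simp [symp, ofX])

theorem commute_ofZ_ofZ {n : ℕ} (v w : Fin n → ZMod 2) : Commute (ofZ v) (ofZ w) :=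
  commute_iff.mpr (by simp [symp, ofZ])

/-- The quantum Hamming code with six gauge qubits, whose Pauli `Z` operators are given by the
products of two rows. The Pauli `X` operators come from the complementary products: the product of
all four rows has odd weight, and that of at most three of them has even weight. -/
def hammingSubsystem : SubsystemCode 15 6 where
  code := hammingCode
  gaugeX k := ofX (hammingProduct k.rev)
  gaugeZ k := ofZ (hammingProduct k)
  isLogicalFamily := by
    refine ⟨fun k => ⟨?_, isObservable_ofX _⟩, fun k => ⟨?_, isObservable_ofZ _⟩,
      fun _ _ => commute_ofX_ofX _ _, fun _ _ => commute_ofZ_ofZ _ _,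
      fun k => antiCommute_iff.mpr ?_, fun k l h => commute_iff.mpr ?_⟩
    · exact mem_logicalPaulis_of_symp hammingCode_isGenerators
        fun j => (symp_hammingGen_hammingProduct j _).1
    · exact mem_logicalPaulis_of_symp hammingCode_isGenerators
        fun j => (symp_hammingGen_hammingProduct j _).2
    · rw [symp_hammingProduct, if_pos rfl]
    · rw [symp_hammingProduct, if_neg h]

theorem reedMullerCode_isGaugeFixing : hammingSubsystem.IsGaugeFixing reedMullerCode 6 := by
  refine ⟨hammingSubsystem.gaugeZ, fun k => Subgroup.subset_closure (Or.inr ⟨k, rfl⟩),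
    reedMullerStab_eq_sup, fun k hk => ?_⟩
  change _ ∈ hammingStab ⊔ _ at hk
  rw [← closure_hammingGen, ← Subgroup.closure_union] at hk
  have h := symp_closure (s := {ofX (hammingProduct k.rev)}) (by
    rintro _ rfl _ (⟨j, rfl⟩ | ⟨j, hj, rfl⟩)
    · rw [symp_comm]; exact (symp_hammingGen_hammingProduct j _).1
    · exact (symp_hammingProduct k j).trans (if_neg fun h => hj h.symm))
    (Subgroup.subset_closure rfl) hk
  have h' := symp_hammingProduct k k
  rw [if_pos rfl] at h'
  exact absurd (h.symm.trans h') (by decide)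

theorem reedMullerCode_isLogicalBasis :
    reedMullerCode.IsLogicalBasis (fun _ : Fin 1 => ofX 1) (fun _ : Fin 1 => ofZ 1) := by
  have hX : ∀ j, symp (reedMullerGen j) (ofX 1) = 0 := by decide +kernel
  have hZ : ∀ j, symp (reedMullerGen j) (ofZ 1) = 0 := by decide +kernel
  have hXZ : symp (ofX 1 : Pauli 15) (ofZ 1) = 1 := by decide +kernel
  refine ⟨⟨14, _, reedMullerCode_isGenerators, rfl⟩, fun _ => ⟨?_, isObservable_ofX _⟩,
    fun _ => ⟨?_, isObservable_ofZ _⟩, fun _ _ => commute_ofX_ofX _ _,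
    fun _ _ => commute_ofZ_ofZ _ _, fun _ => antiCommute_iff.mpr hXZ,
    fun i j h => absurd (Subsingleton.elim i j) h⟩
  · exact mem_logicalPaulis_of_symp reedMullerCode_isGenerators hX
  · exact mem_logicalPaulis_of_symp reedMullerCode_isGenerators hZ

/-- The rewiring of the last generator `Z_{h₂ h₃}`, in which `g = X_{h₀ h₁}` and `g'` is
`X_L Z_L Z_{h₂ h₃} g`. -/
def sqrtYRewiring : Rewiring 15 14 where
  idx := 13
  g := ofX (hammingProduct 0)
  g' := ofX 1 * ofZ 1 * reedMullerGen 13 * ofX (hammingProduct 0)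

theorem sqrtYRewiring_isRewiringPair : sqrtYRewiring.IsRewiringPair reedMullerGen
    (fun _ : Fin 1 => ofX 1) (fun _ : Fin 1 => ofZ 1) := by
  have h1 : ∀ j : Fin 14, j ≠ 13 → symp sqrtYRewiring.g (reedMullerGen j) = 0 := by
    decide +kernel
  have h2 : ∀ j : Fin 14, j ≠ 13 → symp sqrtYRewiring.g' (reedMullerGen j) = 0 := by
    decide +kernel
  have h3 : symp sqrtYRewiring.g (ofZ 1) = 0 := by decide +kernel
  refine ⟨isObservable_ofX _, ?_, ⟨fun j hj => commute_iff.mpr (h1 j hj), antiCommute_iff.mpr ?_⟩,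
    fun _ => ⟨commute_ofX_ofX _ _, commute_iff.mpr h3⟩,
    ⟨fun j hj => commute_iff.mpr (h2 j hj), antiCommute_iff.mpr ?_⟩, antiCommute_iff.mpr ?_⟩
  · rw [IsObservable, mul_self, one_def, Pauli.mk.injEq]
    exact ⟨by decide +kernel, rfl, rfl⟩
  all_goals decide +kernel

/-- The rewiring is the quarter turn about `X_L Z_L`, which is a multiple of `√Y_L`. -/
theorem sqrtYRewiring_induces : reedMullerCode.Induces (sqrtYRewiring.process reedMullerGen)
    (sqrtOp (imag 15 * ofX 1 * ofZ 1).toMatrix) := by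
  intro ρ hρ
  have hmem : reedMullerGen 13 ∈ reedMullerCode.stab :=
    reedMullerCode_isGenerators.1 ▸ Subgroup.subset_closure ⟨13, rfl⟩
  have hl : (reedMullerGen 13).toMatrix * ρ = ρ := by
    rw [← hρ.proj_mul, ← mul_assoc, reedMullerCode.mul_proj hmem]
  have hr : ρ * (reedMullerGen 13).toMatrix = ρ := by
    rw [← hρ.mul_proj, mul_assoc, reedMullerCode.proj_mul hmem]
  rw [sqrtYRewiring_isRewiringPair.process_eq (reedMullerCode.mul_self_of_mem_stab hmem) hl hr]
  have hK : sqrtYRewiring.g' * sqrtYRewiring.g = ofX 1 * ofZ 1 * reedMullerGen 13 := by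
    have : ofX (hammingProduct 0) * ofX (hammingProduct 0) = 1 := isObservable_ofX _
    rw [sqrtYRewiring, mul_assoc, this, mul_one]
  have hGc : (reedMullerGen 13).toMatrixᴴ = (reedMullerGen 13).toMatrix :=
    reedMullerCode.conjTranspose_toMatrix_of_mem_stab hmem
  have hY : (imag 15 * ofX 1 * ofZ 1).toMatrix = Complex.I • (ofX 1 * ofZ 1).toMatrix := by
    rw [mul_assoc, toMatrix_mul]; simp
  rw [hK, hY, quarterTurn, toMatrix_mul (ofX 1 * ofZ 1)]
  generalize (reedMullerGen 13).toMatrix = G at *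
  generalize (ofX 1 * ofZ 1 : Pauli 15).toMatrix = T
  have hS : sqrtOp (Complex.I • T) = ((1 + Complex.I) / 2) • (1 + T) := by
    rw [sqrtOp]
    simp only [smul_add, smul_sub, smul_smul]
    have e1 : Complex.I / 2 * Complex.I = -1 / 2 := by
      rw [div_mul_eq_mul_div, Complex.I_mul_I]
    rw [e1]
    module
  have hl' : (1 + T * G) * ρ = (1 + T) * ρ := by
    rw [add_mul, add_mul, mul_assoc, hl]
  have hr' : ∀ A : QubitOp 15, A * ρ * (1 + T * G)ᴴ = A * ρ * (1 + T)ᴴ := fun A => by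
    rw [Matrix.conjTranspose_add, Matrix.conjTranspose_add, Matrix.conjTranspose_mul, hGc, mul_add,
      mul_add, ← mul_assoc (A * ρ), mul_assoc A ρ G, hr]
  have hc : (1 + Complex.I) / 2 * star ((1 + Complex.I) / 2) = 1 / 2 := by
    simp only [Complex.star_def, map_div₀, map_add, map_one, Complex.conj_I, Complex.conj_ofNat]
    linear_combination (-1 / 4 : ℂ) * Complex.I_sq
  have hc' : (Real.sqrt 2 : ℂ)⁻¹ * star ((Real.sqrt 2 : ℂ)⁻¹) = 1 / 2 := by
    rw [← StabilizerCode.inv_sqrt_two_mul_self]; simp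
  rw [hS, Matrix.conjTranspose_smul, Matrix.conjTranspose_smul]
  simp only [smul_mul_assoc, mul_smul_comm, smul_smul]
  rw [hr', hl', mul_comm, hc', mul_comm, hc]

end HammingCodes

theorem theorem2 :
    (∀ (n r s d : ℕ) (Chat : SubsystemCode n r) (C : StabilizerCode n),
      1 ≤ r → Chat.code.distance = d → 1 ≤ s → Chat.IsGaugeFixing C s →
      (d : ℕ∞) ≤ C.distance ∧
      ∃ (m : ℕ) (gen : Fin m → Pauli n), C.IsGenerators gen ∧
        ∀ (k : ℕ) (X Z : Fin k → Pauli n), C.IsLogicalBasis X Z →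
          ∀ W : QubitOp n, C.IsClifford W →
            ∃ l : List (Rewiring n m),
              (∀ R ∈ l, R.IsRewiringPair gen X Z ∧ R.IntermediateDistanceGE gen d) ∧
              C.Induces (Rewiring.processList l gen) W) ∧
    (∃ (Chat : SubsystemCode 15 6) (C : StabilizerCode 15),
      Chat.code.stab = hammingStab ∧ Chat.code.Encodes 7 ∧ Chat.code.distance = 3 ∧
      C.stab = reedMullerStab ∧ Chat.IsGaugeFixing C 6 ∧
      C.IsLogicalBasis (fun _ : Fin 1 => Pauli.ofX 1) (fun _ : Fin 1 => Pauli.ofZ 1) ∧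
      3 ≤ C.distance ∧
      ∃ (m : ℕ) (gen : Fin m → Pauli 15) (R : Rewiring 15 m) (W : QubitOp 15),
        C.IsGenerators gen ∧
        R.IsRewiringPair gen (fun _ : Fin 1 => Pauli.ofX 1) (fun _ : Fin 1 => Pauli.ofZ 1) ∧
        R.IntermediateDistanceGE gen 3 ∧
        IsSqrtType (Pauli.imag 15 * Pauli.ofX 1 * Pauli.ofZ 1).toMatrix W ∧
        C.Induces (R.process gen) W) := by
  refine ⟨fun n r s d Chat C _ hd hs hfix => ?_, ?_⟩
  · rw [← hd]
    exact gaugeFixing_rewiring hs hfix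
  · have h3 : 3 ≤ reedMullerCode.distance :=
      three_le_hammingCode_distance.trans (StabilizerCode.distance_mono hammingStab_le)
    refine ⟨hammingSubsystem, reedMullerCode, rfl, ⟨8, _, hammingCode_isGenerators, rfl⟩,
      hammingCode_distance, rfl, reedMullerCode_isGaugeFixing, reedMullerCode_isLogicalBasis, h3,
      14, reedMullerGen, sqrtYRewiring, _, reedMullerCode_isGenerators,
      sqrtYRewiring_isRewiringPair, ?_, Or.inl rfl, sqrtYRewiring_induces⟩
    rw [← hammingCode_distance]
    refine sqrtYRewiring_isRewiringPair.intermediateDistanceGE reedMullerCode_isGenerators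
      (D := hammingCode) ?_
    change hammingStab ≤ _
    rw [← closure_hammingGen]
    refine Subgroup.closure_mono ?_
    rintro _ ⟨j, rfl⟩
    refine ⟨Fin.castAdd 6 j, fun h => ?_, by simp [reedMullerGen]⟩
    have hj : j.val = 13 := congrArg Fin.val h
    omega
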